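/- Let $\mathcal{H}$ be a complex Hilbert space, finite- or infinite-dimensional, and let $\mathcal{L}(\mathcal{H})$ and $\mathcal{T}(\mathcal{H})$ denote the bounded and the trace class operators on $\mathcal{H}$. A state is a positive trace class operator of trace $1$. An observable on $\mathcal{H}$ with finite outcome set $\Omega$ is a map $\mathsf{A}:\Omega\to\mathcal{L}(\mathcal{H})$ with $\mathsf{A}(x)\ge 0$ and $\sum_x\mathsf{A}(x)=I$. A channel $\Lambda:\mathcal{T}(\mathcal{H})\to\mathcal{T}(\mathcal{H}')$ is a completely positive trace preserving linear map. The dual $\Phi^*:\mathcal{L}(\mathcal{H}')\to\mathcal{L}(\mathcal{H})$ of a linear map $\Phi:\mathcal{T}(\mathcal{H})\to\mathcal{T}(\mathcal{H}')$ is the linear map determined by $\mathrm{tr}[T\,\Phi^*(X)]=\mathrm{tr}[\Phi(T)X]$ for all trace class $T$ and bounded $X$. Let $\mathsf{A}$ and $\mathsf{B}$ be observables on $\mathcal{H}$ with finite outcome sets $\Omega_{\mathsf A}$ and $\Omega_{\mathsf B}$. A joint observable of $\mathsf{A}$ and $\mathsf{B}$ is an observable $\mathsf{J}$ on $\mathcal{H}$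 with outcome set $\Omega_{\mathsf A}\times\Omega_{\mathsf B}$ such that $\sum_y\mathsf{J}(x,y)=\mathsf{A}(x)$ and $\sum_x\mathsf{J}(x,y)=\mathsf{B}(y)$ for all $x,y$. In the following, conditions are required for all states $\varrho$ on $\mathcal H$ and all outcomes $x\in\Omega_{\mathsf A}$, $y\in\Omega_{\mathsf B}$. The pair $\mathsf{A},\mathsf{B}$ is * broadcastable if there is a channel $\Lambda:\mathcal{T}(\mathcal{H})\to\mathcal{T}(\mathcal{H}\otimes\mathcal{H})$ with $\mathrm{tr}[\varrho\mathsf{A}(x)]=\mathrm{tr}[\Lambda(\varrho)\,\mathsf{A}(x)\otimes I]=\mathrm{tr}[\Lambda(\varrho)\,I\otimes\mathsf{A}(x)]$ and $\mathrm{tr}[\varrho\mathsf{B}(y)]=\mathrm{tr}[\Lambda(\varrho)\,\mathsf{B}(y)\otimes I]=\mathrm{tr}[\Lambda(\varrho)\,I\otimes\mathsf{B}(y)]$; * one-side broadcastable if there is a channel $\Lambda:\mathcal{T}(\mathcal{H})\to\mathcal{T}(\mathcal{H}\otimes\mathcal{H})$ with $\mathrm{tr}[\varrho\mathsf{A}(x)]=\mathrm{tr}[\Lambda(\varrho)\,\mathsf{A}(x)\otimes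 I]$ and $\mathrm{tr}[\varrho\mathsf{B}(y)]=\mathrm{tr}[\Lambda(\varrho)\,I\otimes\mathsf{B}(y)]$; * mutually nondisturbing (respectively nondisturbing) if $\mathsf{A}$ can be measured without disturbing $\mathsf{B}$ and (respectively or) $\mathsf{B}$ can be measured without disturbing $\mathsf{A}$; * compatible if it has a joint observable. Here $\mathsf{A}$ can be measured without disturbing $\mathsf{B}$ if there is an instrument $(\mathcal{I}_x)_{x\in\Omega_{\mathsf A}}$, that is, a family of completely positive linear maps $\mathcal{I}_x:\mathcal{T}(\mathcal{H})\to\mathcal{T}(\mathcal{H})$, with $$\text{(i)}\ \ \mathrm{tr}[\mathcal{I}_x(\varrho)]=\mathrm{tr}[\varrho\mathsf{A}(x)],\qquad \text{(ii)}\ \ \mathrm{tr}\Big[\sum_{x}\mathcal{I}_x(\varrho)\mathsf{B}(y)\Big]=\mathrm{tr}[\varrho\mathsf{B}(y)].$$ Then the following implications hold: $$\text{broadcastable}\Rightarrow\text{one-side broadcastable}\Rightarrow\text{mutually nondisturbing}\Rightarrow\text{nondisturbing}\Rightarrow\text{compatible}.$$ Moreover: 1. Every channel that satisfies the broadcasting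 conditions satisfies the one-side broadcasting conditions. 2. If a channel $\Lambda$ satisfies the one-side broadcasting conditions, then the dual $\Lambda^*$ exists and is unique, and $\mathsf{J}(x,y)=\Lambda^*(\mathsf{A}(x)\otimes\mathsf{B}(y))$ is a joint observable of $\mathsf{A}$ and $\mathsf{B}$. 3. Let $\mathcal{K}$ be a Hilbert space, $\mathsf{A}'$ an observable on $\mathcal{K}$ with outcome set $\Omega_{\mathsf A}$ and $\Lambda:\mathcal{T}(\mathcal{H})\to\mathcal{T}(\mathcal{K}\otimes\mathcal{H})$ a channel such that $\mathrm{tr}[\varrho\mathsf{A}(x)]=\mathrm{tr}[\Lambda(\varrho)\,\mathsf{A}'(x)\otimes I]$ and $\mathrm{tr}[\varrho\mathsf{B}(y)]=\mathrm{tr}[\Lambda(\varrho)\,I\otimes\mathsf{B}(y)]$. Then $\mathcal{I}_x(T)=\mathrm{tr}_{\mathcal{K}}\big[(\sqrt{\mathsf{A}'(x)}\otimes I)\,\Lambda(T)\,(\sqrt{\mathsf{A}'(x)}\otimes I)\big]$, $T\in\mathcal{T}(\mathcal{H})$, defines an instrument that satisfies (i) and (ii). 4. If an instrument $(\mathcal{I}_x)$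 satisfies (i) and (ii), then each dual $\mathcal{I}_x^*$ exists and is unique, and $\mathsf{J}(x,y)=\mathcal{I}_x^*(\mathsf{B}(y))$ is a joint observable of $\mathsf{A}$ and $\mathsf{B}$. -/

import Mathlib

open scoped TensorProduct ComplexOrder InnerProductSpace

namespace QuantumMeasurement

universe u v w

section TraceClass

variable (H : Type u) [NormedAddCommGroup H] [InnerProductSpace ℂ H] [CompleteSpace H]

/-- The index set of a fixed orthonormal basis of `H`. -/
noncomputable def basisIndex : Set H := (exists_hilbertBasis ℂ H).choose

/-- A fixed orthonormal basis of the Hilbert space `H`. -/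
noncomputable def basis : HilbertBasis (basisIndex H) ℂ H :=
  (exists_hilbertBasis ℂ H).choose_spec.choose

variable {H}

/-- The trace `∑ᵢ ⟨eᵢ, T eᵢ⟩`. On trace class operators the series converges absolutely and its
value does not depend on the orthonormal basis. -/
noncomputable def trace (T : H →L[ℂ] H) : ℂ :=
  ∑' i, inner ℂ (basis H i) (T (basis H i))

variable (H)

/-- The space of trace class operators on `H`: the linear span of the positive operators
of finite trace. -/
noncomputable def traceClass : Submodule ℂ (H →L[ℂ] H) :=
  Submodule.span ℂ
    {T | 0 ≤ T ∧ Summable fun i => inner ℂ (basis H i) (T (basis H i))}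

variable {H}

/-- States (density operators): positive trace class operators of trace one. -/
def IsState (ρ : traceClass H) : Prop :=
  0 ≤ (ρ : H →L[ℂ] H) ∧ trace (ρ : H →L[ℂ] H) = 1

end TraceClass

section Maps

variable {H : Type u} [NormedAddCommGroup H] [InnerProductSpace ℂ H] [CompleteSpace H]
variable {K : Type v} [NormedAddCommGroup K] [InnerProductSpace ℂ K] [CompleteSpace K]

/-- Positivity of an `n × n` matrix of operators on `H`, as an operator on `Hⁿ`. -/
def BlockPositive {n : ℕ} (T : Fin n → Fin n → (H →L[ℂ] H)) : Prop :=
  ∀ ξ : Fin n → H, 0 ≤ ∑ i, ∑ j, inner ℂ (ξ i) (T i j (ξ j))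

/-- Complete positivity: every amplification `id_n ⊗ Φ` is positive. -/
def IsCompletelyPositive (Φ : traceClass H →ₗ[ℂ] traceClass K) : Prop :=
  ∀ (n : ℕ) (T : Fin n → Fin n → traceClass H),
    BlockPositive (fun i j => (T i j : H →L[ℂ] H)) →
      BlockPositive (fun i j => (Φ (T i j) : K →L[ℂ] K))

/-- Quantum channels (in the Schrödinger picture): completely positive trace preserving
linear maps. -/
structure IsChannel (Φ : traceClass H →ₗ[ℂ] traceClass K) : Prop where
  completelyPositive : IsCompletelyPositive Φ
  trace_preserving : ∀ T : traceClass H,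
    trace (Φ T : K →L[ℂ] K) = trace (T : H →L[ℂ] H)

/-- `D` is the dual map `Φ*` (the Heisenberg picture) of `Φ`:
`tr(T Φ*(X)) = tr(Φ(T) X)` for all trace class `T` and bounded `X`. -/
def IsDualMap (Φ : traceClass H →ₗ[ℂ] traceClass K)
    (D : (K →L[ℂ] K) →ₗ[ℂ] (H →L[ℂ] H)) : Prop :=
  ∀ (T : traceClass H) (X : K →L[ℂ] K),
    trace ((T : H →L[ℂ] H) * D X) = trace ((Φ T : K →L[ℂ] K) * X)

end Maps

section Tensor

variable (K : Type u) [NormedAddCommGroup K] [InnerProductSpace ℂ K]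
variable (H : Type v) [NormedAddCommGroup H] [InnerProductSpace ℂ H]

/-- The Hilbert space tensor product `K ⊗ H`. -/
abbrev HilbertTensor : Type (max u v) := UniformSpace.Completion (K ⊗[ℂ] H)

variable {K H}

/-- The bounded operator `S ⊗ T` on the Hilbert space `K ⊗ H`. -/
noncomputable def tensorOp (S : K →L[ℂ] K) (T : H →L[ℂ] H) :
    HilbertTensor K H →L[ℂ] HilbertTensor K H :=
  (TensorProduct.mapL S T).completion

/-- The bounded operator `H → K ⊗ H`, `η ↦ ξ ⊗ η`. -/
noncomputable def tensorLeft (ξ : K) : H →L[ℂ] HilbertTensor K H :=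
  UniformSpace.Completion.toComplL ∘L TensorProduct.mkL ℂ K H ξ

/-- The partial trace `tr_K S = ∑ᵢ Vᵢ* S Vᵢ` over the first factor, where `Vᵢ η = eᵢ ⊗ η`
for the orthonormal basis `(eᵢ)` of `K`; that is, `⟨η, (tr_K S) ζ⟩ = ∑ᵢ ⟨eᵢ ⊗ η, S (eᵢ ⊗ ζ)⟩`.
For trace class `S` the series converges absolutely in norm. -/
noncomputable def partialTrace [CompleteSpace K] [CompleteSpace H]
    (S : HilbertTensor K H →L[ℂ] HilbertTensor K H) : H →L[ℂ] H :=
  ∑' i, (ContinuousLinearMap.adjoint (tensorLeft (H := H) (basis K i))) ∘L S ∘L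
    (tensorLeft (H := H) (basis K i))

end Tensor

/-- Quantum observables (POVMs) on `H` with finite outcome set `Ω`. -/
structure Observable (Ω : Type v) [Fintype Ω] (H : Type u) [NormedAddCommGroup H]
    [InnerProductSpace ℂ H] [CompleteSpace H] where
  /-- The effect of an outcome. -/
  effect : Ω → (H →L[ℂ] H)
  effect_nonneg : ∀ x, 0 ≤ effect x
  sum_effect : ∑ x, effect x = 1

section Relations

variable {ΩA : Type v} [Fintype ΩA] {ΩB : Type w} [Fintype ΩB]
variable {H : Type u} [NormedAddCommGroup H] [InnerProductSpace ℂ H] [CompleteSpace H]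

/-- `J` is a joint observable of `A` and `B`. -/
structure IsJointObservable (J : ΩA × ΩB → (H →L[ℂ] H)) (A : Observable ΩA H)
    (B : Observable ΩB H) : Prop where
  nonneg : ∀ z, 0 ≤ J z
  sum_eq_one : ∑ z, J z = 1
  marginal_left : ∀ x, ∑ y, J (x, y) = A.effect x
  marginal_right : ∀ y, ∑ x, J (x, y) = B.effect y

/-- Compatibility (joint measurability). -/
def Compatible (A : Observable ΩA H) (B : Observable ΩB H) : Prop :=
  ∃ J : ΩA × ΩB → (H →L[ℂ] H), IsJointObservable J A B

/-- The map `Λ` broadcasts the observable `A`. -/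
def Broadcasts (Λ : traceClass H →ₗ[ℂ] traceClass (HilbertTensor H H))
    (A : Observable ΩA H) : Prop :=
  ∀ ρ : traceClass H, IsState ρ → ∀ x,
    trace ((ρ : H →L[ℂ] H) * A.effect x) = trace ((Λ ρ).1 * tensorOp (A.effect x) 1) ∧
    trace ((ρ : H →L[ℂ] H) * A.effect x) = trace ((Λ ρ).1 * tensorOp 1 (A.effect x))

/-- The pair `A`, `B` is broadcastable: one channel broadcasts both observables. -/
def Broadcastable (A : Observable ΩA H) (B : Observable ΩB H) : Prop :=
  ∃ Λ : traceClass H →ₗ[ℂ] traceClass (HilbertTensor H H),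
    IsChannel Λ ∧ Broadcasts Λ A ∧ Broadcasts Λ B

/-- Measuring `A'` on the first and `B'` on the second output system of `Λ` reproduces the
statistics of `A` and `B`. -/
def Reproduces {K₁ : Type*} [NormedAddCommGroup K₁] [InnerProductSpace ℂ K₁] [CompleteSpace K₁]
    {K₂ : Type*} [NormedAddCommGroup K₂] [InnerProductSpace ℂ K₂] [CompleteSpace K₂]
    (Λ : traceClass H →ₗ[ℂ] traceClass (HilbertTensor K₁ K₂))
    (A' : Observable ΩA K₁) (B' : Observable ΩB K₂)
    (A : Observable ΩA H) (B : Observable ΩB H) : Prop :=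
  ∀ ρ : traceClass H, IsState ρ →
    (∀ x, trace ((ρ : H →L[ℂ] H) * A.effect x) =
      trace ((Λ ρ).1 * tensorOp (A'.effect x) 1)) ∧
    (∀ y, trace ((ρ : H →L[ℂ] H) * B.effect y) =
      trace ((Λ ρ).1 * tensorOp 1 (B'.effect y)))

/-- One-side broadcastability. -/
def OneSideBroadcastable (A : Observable ΩA H) (B : Observable ΩB H) : Prop :=
  ∃ Λ : traceClass H →ₗ[ℂ] traceClass (HilbertTensor H H),
    IsChannel Λ ∧ Reproduces Λ A B A B

/-- `I` is an instrument that implements a measurement of `A`. -/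
structure IsInstrumentOf (I : ΩA → (traceClass H →ₗ[ℂ] traceClass H))
    (A : Observable ΩA H) : Prop where
  completelyPositive : ∀ x, IsCompletelyPositive (I x)
  trace_eq : ∀ ρ : traceClass H, IsState ρ → ∀ x,
    trace (I x ρ : H →L[ℂ] H) = trace ((ρ : H →L[ℂ] H) * A.effect x)

/-- The total operation `I_Ω = ∑ₓ Iₓ` leaves the statistics of `B` unchanged. -/
def DoesNotDisturb (I : ΩA → (traceClass H →ₗ[ℂ] traceClass H))
    (B : Observable ΩB H) : Prop :=
  ∀ ρ : traceClass H, IsState ρ → ∀ y,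
    trace ((ρ : H →L[ℂ] H) * B.effect y) = trace (((∑ x, I x) ρ).1 * B.effect y)

/-- `A` can be measured without disturbing `B`. -/
def MeasurableWithoutDisturbing (A : Observable ΩA H) (B : Observable ΩB H) : Prop :=
  ∃ I : ΩA → (traceClass H →ₗ[ℂ] traceClass H), IsInstrumentOf I A ∧ DoesNotDisturb I B

/-- Mutual nondisturbance. -/
def MutuallyNondisturbing (A : Observable ΩA H) (B : Observable ΩB H) : Prop :=
  MeasurableWithoutDisturbing A B ∧ MeasurableWithoutDisturbing B A

/-- Nondisturbance. -/
def Nondisturbing (A : Observable ΩA H) (B : Observable ΩB H) : Prop :=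
  MeasurableWithoutDisturbing A B ∨ MeasurableWithoutDisturbing B A

end Relations

end QuantumMeasurement

/-! Everything is tested against the functionals T ↦ tr(TX), written `traceMul X`. Conditions on
states become equalities of linear functionals, because a positive trace class operator is a
multiple of a state or zero (`linearMap_ext_states`); equalities of operators are read off from rank
one operators (`ext_traceMul`).

The analytic core is the existence of duals (`existsUnique_isDualMap`), where no continuity of Φ is
assumed. Positivity alone gives |tr(Φ(R)X)| ≤ ‖X‖ tr Φ(R) ≤ ‖X‖‖E‖ tr R for R ≥ 0, if tr Φ(·) = tr(·
E). Such a functional is a bounded sesquilinear form on the operators |x⟩⟨y|, hence given there by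
an operator, and approximating positive operators from below by finite sums of rank ones extends
this to the whole trace class.

Given the duals, Λ*(A(x) ⊗ B(y)) and Iₓ*(B(y)) are positive, and their marginals follow by summing
one observable to 1. For the Lüders-type instrument all is contained in tr(Iₓ(T)X) = tr(Λ(T) A'(x) ⊗
X) (`trace_luedersMap_mul`): X = 1 gives (i), summation over x with X = B(y) gives (ii). Composing Λ
with the swap of the tensor factors exchanges A and B, which makes nondisturbance mutual. -/

set_option linter.unusedSectionVars false

namespace QuantumMeasurement

/-! ### Hilbert–Schmidt operators -/

section HilbertSchmidt

variable {H : Type*} [NormedAddCommGroup H] [InnerProductSpace ℂ H] [CompleteSpace H]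
variable {K : Type*} [NormedAddCommGroup K] [InnerProductSpace ℂ K] [CompleteSpace K]
variable {L : Type*} [NormedAddCommGroup L] [InnerProductSpace ℂ L] [CompleteSpace L]
variable {ι κ : Type*}

open ContinuousLinearMap (adjoint)

theorem hasSum_norm_inner_sq (b : HilbertBasis ι ℂ H) (x : H) :
    HasSum (fun i => ‖inner ℂ (b i) x‖ ^ 2) (‖x‖ ^ 2) := by
  have h := b.hasSum_inner_mul_inner x x
  have h2 := Complex.hasSum_re h
  convert h2 using 1
  · ext i
    rw [← inner_conj_symm x (b i), ← Complex.normSq_eq_conj_mul_self, Complex.ofReal_re,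
      Complex.normSq_eq_norm_sq]
  · exact (inner_self_eq_norm_sq (𝕜 := ℂ) x).symm

theorem summable_norm_inner_sq_prod (b : HilbertBasis ι ℂ H) (c : HilbertBasis κ ℂ K)
    (S : H →L[ℂ] K) (h : Summable fun i => ‖S (b i)‖ ^ 2) :
    Summable fun p : ι × κ => ‖inner ℂ (c p.2) (S (b p.1))‖ ^ 2 := by
  rw [summable_prod_of_nonneg (fun _ => by positivity)]
  refine ⟨fun i => (hasSum_norm_inner_sq c (S (b i))).summable, ?_⟩
  simpa only [(hasSum_norm_inner_sq c _).tsum_eq] using h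

/-- Both sums equal the double sum of |⟨cⱼ, S bᵢ⟩|², by Parseval. As the two bases are unrelated,
passing to the adjoint twice changes the basis of `H`. -/
theorem summable_norm_sq_adjoint (b : HilbertBasis ι ℂ H) (c : HilbertBasis κ ℂ K)
    (S : H →L[ℂ] K) (h : Summable fun i => ‖S (b i)‖ ^ 2) :
    Summable fun j => ‖adjoint S (c j)‖ ^ 2 := by
  have h1 := (summable_norm_inner_sq_prod b c S h).prod_symm.prod
  refine h1.congr fun j => ?_
  rw [← (hasSum_norm_inner_sq b (adjoint S (c j))).tsum_eq]
  refine tsum_congr fun i => ?_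
  rw [ContinuousLinearMap.adjoint_inner_right, norm_inner_symm]
  rfl

/-- Hilbert–Schmidt operators. -/
def IsHilbertSchmidt (S : H →L[ℂ] K) : Prop :=
  Summable fun i => ‖S (basis H i)‖ ^ 2

namespace IsHilbertSchmidt

theorem adjoint {S : H →L[ℂ] K} (h : IsHilbertSchmidt S) : IsHilbertSchmidt (adjoint S) :=
  summable_norm_sq_adjoint _ _ S h

theorem summable {S : H →L[ℂ] K} (h : IsHilbertSchmidt S) (b : HilbertBasis ι ℂ H) :
    Summable fun i => ‖S (b i)‖ ^ 2 := by
  simpa using summable_norm_sq_adjoint (basis K) b _ h.adjoint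

theorem comp_left {S : H →L[ℂ] K} (h : IsHilbertSchmidt S) (X : K →L[ℂ] L) :
    IsHilbertSchmidt (X ∘L S) := by
  refine Summable.of_nonneg_of_le (fun _ => by positivity) (fun i => ?_) (h.mul_left (‖X‖ ^ 2))
  rw [← mul_pow]
  exact pow_le_pow_left₀ (norm_nonneg _) (X.le_opNorm _) 2

theorem comp_right {S : K →L[ℂ] L} (h : IsHilbertSchmidt S) (X : H →L[ℂ] K) :
    IsHilbertSchmidt (S ∘L X) := by
  have := (h.adjoint.comp_left (ContinuousLinearMap.adjoint X)).adjoint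
  rwa [← ContinuousLinearMap.adjoint_comp, ContinuousLinearMap.adjoint_adjoint] at this

theorem smul {S : H →L[ℂ] K} (h : IsHilbertSchmidt S) (c : ℂ) : IsHilbertSchmidt (c • S) := by
  simpa [IsHilbertSchmidt, norm_smul, mul_pow] using Summable.mul_left (‖c‖ ^ 2) h

theorem add {S T : H →L[ℂ] K} (hS : IsHilbertSchmidt S) (hT : IsHilbertSchmidt T) :
    IsHilbertSchmidt (S + T) := by
  refine Summable.of_nonneg_of_le (fun _ => by positivity) (fun i => ?_)
    ((Summable.add hS hT).mul_left 2)
  have h1 := norm_add_le (S (basis H i)) (T (basis H i))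
  have h2 := norm_nonneg (S (basis H i) + T (basis H i))
  simp only [add_apply]
  nlinarith [sq_nonneg (‖S (basis H i)‖ - ‖T (basis H i)‖)]

end IsHilbertSchmidt

theorem summable_norm_mul_norm {f : ι → H} {g : ι → K} (hf : Summable fun i => ‖f i‖ ^ 2)
    (hg : Summable fun i => ‖g i‖ ^ 2) : Summable fun i => ‖f i‖ * ‖g i‖ := by
  refine Summable.of_nonneg_of_le (fun _ => by positivity) (fun i => ?_) (hf.add hg)
  nlinarith [sq_nonneg (‖f i‖ - ‖g i‖), sq_nonneg (‖f i‖), sq_nonneg (‖g i‖)]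

theorem summable_inner_hilbertSchmidt (b : HilbertBasis ι ℂ H) {S T : H →L[ℂ] K}
    (hS : IsHilbertSchmidt S) (hT : IsHilbertSchmidt T) :
    Summable fun i => inner ℂ (S (b i)) (T (b i)) :=
  Summable.of_norm_bounded (summable_norm_mul_norm (hS.summable b) (hT.summable b))
    fun _ => norm_inner_le_norm _ _

/-- Insert the basis of `K` and exchange the sums, which converge absolutely. This is the source of
both the basis independence and the cyclicity of the trace. -/
theorem tsum_inner_hilbertSchmidt (b : HilbertBasis ι ℂ H) (c : HilbertBasis κ ℂ K)
    {S T : H →L[ℂ] K} (hS : IsHilbertSchmidt S) (hT : IsHilbertSchmidt T) :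
    ∑' i, inner ℂ (S (b i)) (T (b i)) = ∑' j, inner ℂ (adjoint T (c j)) (adjoint S (c j)) := by
  have hs : Summable fun p : ι × κ =>
      inner ℂ (S (b p.1)) (c p.2) * inner ℂ (c p.2) (T (b p.1)) := by
    refine Summable.of_norm_bounded (summable_norm_mul_norm
      (summable_norm_inner_sq_prod b c S (hS.summable b))
      (summable_norm_inner_sq_prod b c T (hT.summable b))) fun p => ?_
    rw [norm_mul, norm_inner_symm]
  calc ∑' i, inner ℂ (S (b i)) (T (b i))
      = ∑' i, ∑' j, inner ℂ (S (b i)) (c j) * inner ℂ (c j) (T (b i)) :=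
        tsum_congr fun i => (c.tsum_inner_mul_inner _ _).symm
    _ = ∑' j, ∑' i, inner ℂ (S (b i)) (c j) * inner ℂ (c j) (T (b i)) :=
        Summable.tsum_comm hs.prod_symm
    _ = _ := by
        refine tsum_congr fun j => ?_
        rw [← b.tsum_inner_mul_inner]
        refine tsum_congr fun i => ?_
        rw [ContinuousLinearMap.adjoint_inner_left, ContinuousLinearMap.adjoint_inner_right,
          mul_comm]

end HilbertSchmidt

/-! ### Trace class operators and the trace -/

section TraceClass

variable {H : Type*} [NormedAddCommGroup H] [InnerProductSpace ℂ H] [CompleteSpace H]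
variable {K : Type*} [NormedAddCommGroup K] [InnerProductSpace ℂ K] [CompleteSpace K]
variable {ι : Type*}

open ContinuousLinearMap (adjoint)

theorem nonneg_iff_inner {T : H →L[ℂ] H} : 0 ≤ T ↔ ∀ x, 0 ≤ inner ℂ x (T x) := by
  rw [ContinuousLinearMap.nonneg_iff_isPositive]
  refine ⟨fun h x => h.inner_nonneg_right x, fun h => ?_⟩
  rw [ContinuousLinearMap.isPositive_iff_complex]
  intro x
  have h1 := h x
  rw [← inner_conj_symm x (T x), Complex.nonneg_iff, Complex.conj_re, Complex.conj_im,
    zero_eq_neg] at h1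
  exact ⟨Complex.ext rfl h1.2.symm, h1.1⟩

theorem exists_eq_adjoint_comp_self {T : H →L[ℂ] H} (hT : 0 ≤ T) :
    T = adjoint (CFC.sqrt T) ∘L CFC.sqrt T := by
  have h1 : adjoint (CFC.sqrt T) = CFC.sqrt T :=
    (IsSelfAdjoint.of_nonneg (CFC.sqrt_nonneg T)).star_eq
  rw [h1]
  exact (CFC.sqrt_mul_sqrt_self T hT).symm

theorem inner_adjoint_comp (S T : H →L[ℂ] K) (x y : H) :
    inner ℂ x ((adjoint S ∘L T) y) = inner ℂ (S x) (T y) := by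
  rw [ContinuousLinearMap.comp_apply, ContinuousLinearMap.adjoint_inner_right]

theorem inner_adjoint_comp_self (S : H →L[ℂ] K) (x : H) :
    inner ℂ x ((adjoint S ∘L S) x) = ((‖S x‖ ^ 2 : ℝ) : ℂ) := by
  rw [inner_adjoint_comp, inner_self_eq_norm_sq_to_K]
  simp

theorem adjoint_comp_self_nonneg (S : H →L[ℂ] K) : 0 ≤ adjoint S ∘L S :=
  nonneg_iff_inner.2 fun x => by
    rw [inner_adjoint_comp_self]
    exact Complex.zero_le_real.2 (sq_nonneg ‖S x‖)

theorem adjoint_comp_self_mem_traceClass {S : H →L[ℂ] K} (hS : IsHilbertSchmidt S) :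
    adjoint S ∘L S ∈ traceClass H := by
  refine Submodule.subset_span ⟨adjoint_comp_self_nonneg S, ?_⟩
  simp_rw [inner_adjoint_comp_self]
  exact Complex.ofRealCLM.summable hS

theorem isHilbertSchmidt_of_summable {S : H →L[ℂ] K}
    (h : Summable fun i => inner ℂ (basis H i) ((adjoint S ∘L S) (basis H i))) :
    IsHilbertSchmidt S := by
  simp_rw [inner_adjoint_comp_self] at h
  exact Complex.summable_ofReal.1 h

/-- Induction over trace class operators through the operators `S* S`, `S` Hilbert–Schmidt. -/
theorem traceClass_induction {p : ∀ T : H →L[ℂ] H, T ∈ traceClass H → Prop}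
    (hS : ∀ (S : H →L[ℂ] H) (h : IsHilbertSchmidt S),
      p (adjoint S ∘L S) (adjoint_comp_self_mem_traceClass h))
    (hadd : ∀ T (hT : T ∈ traceClass H) R (hR : R ∈ traceClass H),
      p T hT → p R hR → p (T + R) (add_mem hT hR))
    (hsmul : ∀ (c : ℂ) T (hT : T ∈ traceClass H), p T hT → p (c • T) (Submodule.smul_mem _ c hT))
    {T : H →L[ℂ] H} (hT : T ∈ traceClass H) : p T hT := by
  have key : ∀ (T : H →L[ℂ] H) (hT : T ∈ traceClass H),
      0 ≤ T ∧ (Summable fun i => inner ℂ (basis H i) (T (basis H i))) → p T hT := by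
    rintro T hT ⟨h1, h2⟩
    generalize hR : CFC.sqrt T = R
    have h3 := exists_eq_adjoint_comp_self h1
    rw [hR] at h3
    subst h3
    exact hS _ (isHilbertSchmidt_of_summable h2)
  induction hT using Submodule.span_induction with
  | mem x h => exact key x _ h
  | zero => exact key 0 _ ⟨le_rfl, by simp⟩
  | add x y hx hy h1 h2 => exact hadd x hx y hy h1 h2
  | smul a x hx h => exact hsmul a x hx h

/-- Polarization: in the sum of c (T + cS)*(T + cS) over c = 1, -1, i, -i only the terms c c̄ S*T
survive. -/
theorem adjoint_comp_mem_traceClass {S T : H →L[ℂ] K} (hS : IsHilbertSchmidt S)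
    (hT : IsHilbertSchmidt T) : adjoint S ∘L T ∈ traceClass H := by
  have h : ∀ c : ℂ, adjoint (T + c • S) ∘L (T + c • S) ∈ traceClass H := fun c =>
    adjoint_comp_self_mem_traceClass (hT.add (hS.smul c))
  have e : adjoint S ∘L T = (1 / 4 : ℂ) • (adjoint (T + (1 : ℂ) • S) ∘L (T + (1 : ℂ) • S)
      + (-1 : ℂ) • (adjoint (T + (-1 : ℂ) • S) ∘L (T + (-1 : ℂ) • S))
      + Complex.I • (adjoint (T + Complex.I • S) ∘L (T + Complex.I • S))
      + (-Complex.I) • (adjoint (T + (-Complex.I) • S) ∘L (T + (-Complex.I) • S))) := by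
    ext x
    simp only [map_add, map_smulₛₗ, add_apply, smul_apply,
      ContinuousLinearMap.comp_apply, smul_add, smul_smul]
    simp only [map_one, map_neg, Complex.conj_I]
    match_scalars <;> ring_nf <;> simp [Complex.I_sq]; norm_num
  rw [e]
  exact Submodule.smul_mem _ _ (add_mem (add_mem (add_mem (h _) (Submodule.smul_mem _ _ (h _)))
    (Submodule.smul_mem _ _ (h _))) (Submodule.smul_mem _ _ (h _)))

/-- Cyclicity of the trace for Hilbert–Schmidt operators. -/
theorem trace_adjoint_comp {S T : H →L[ℂ] K} (hS : IsHilbertSchmidt S) (hT : IsHilbertSchmidt T) :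
    trace (adjoint S ∘L T) = trace (T ∘L adjoint S) := by
  have h := tsum_inner_hilbertSchmidt (basis H) (basis K) hS hT
  unfold trace
  simp_rw [inner_adjoint_comp]
  rw [h]
  refine tsum_congr fun j => ?_
  rw [ContinuousLinearMap.adjoint_inner_left]
  rfl

theorem hasSum_trace (b : HilbertBasis ι ℂ H) {T : H →L[ℂ] H} (hT : T ∈ traceClass H) :
    HasSum (fun i => inner ℂ (b i) (T (b i))) (trace T) := by
  -- Additivity of `trace` is not yet known, since `tsum` is only additive on summable families.
  -- Carrying a common sum t makes the induction go through.
  suffices h : ∃ t, HasSum (fun i => inner ℂ (b i) (T (b i))) t ∧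
      HasSum (fun i => inner ℂ (basis H i) (T (basis H i))) t by
    obtain ⟨t, h1, h2⟩ := h
    rwa [trace, h2.tsum_eq]
  induction hT using traceClass_induction with
  | hS S hS =>
    simp_rw [inner_adjoint_comp]
    refine ⟨_, (summable_inner_hilbertSchmidt b hS hS).hasSum, ?_⟩
    rw [tsum_inner_hilbertSchmidt b (basis H) hS hS,
      ← tsum_inner_hilbertSchmidt (basis H) (basis H) hS hS]
    exact (summable_inner_hilbertSchmidt (basis H) hS hS).hasSum
  | hadd T hT R hR h1 h2 =>
    obtain ⟨t, h1, h1'⟩ := h1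
    obtain ⟨r, h2, h2'⟩ := h2
    refine ⟨t + r, ?_, ?_⟩
    · simpa only [add_apply, inner_add_right] using h1.add h2
    · simpa only [add_apply, inner_add_right] using h1'.add h2'
  | hsmul c T hT h =>
    obtain ⟨t, h, h'⟩ := h
    refine ⟨c * t, ?_, ?_⟩
    · simpa only [smul_apply, inner_smul_right] using h.mul_left c
    · simpa only [smul_apply, inner_smul_right] using h'.mul_left c

variable (H) in
/-- The trace as a linear functional. -/
noncomputable def traceLinear : traceClass H →ₗ[ℂ] ℂ where
  toFun T := trace (T : H →L[ℂ] H)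
  map_add' T R := by
    refine (hasSum_trace (basis H) (T + R).2).unique ?_
    simpa only [Submodule.coe_add, add_apply, inner_add_right]
      using (hasSum_trace (basis H) T.2).add (hasSum_trace (basis H) R.2)
  map_smul' c T := by
    refine (hasSum_trace (basis H) (c • T).2).unique ?_
    rw [RingHom.id_apply, smul_eq_mul]
    simpa only [Submodule.coe_smul, smul_apply, inner_smul_right]
      using (hasSum_trace (basis H) T.2).mul_left c

theorem trace_add {T R : H →L[ℂ] H} (hT : T ∈ traceClass H) (hR : R ∈ traceClass H) :
    trace (T + R) = trace T + trace R :=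
  map_add (traceLinear H) ⟨T, hT⟩ ⟨R, hR⟩

theorem trace_smul (c : ℂ) {T : H →L[ℂ] H} (hT : T ∈ traceClass H) :
    trace (c • T) = c * trace T :=
  map_smul (traceLinear H) c ⟨T, hT⟩

theorem sandwich_eq (S : H →L[ℂ] H) (A : H →L[ℂ] K) (B : K →L[ℂ] H) :
    A ∘L (adjoint S ∘L S) ∘L B = adjoint (S ∘L adjoint A) ∘L (S ∘L B) := by
  simp [ContinuousLinearMap.adjoint_comp, ContinuousLinearMap.comp_assoc]

theorem comp_comp_mem_traceClass (A : H →L[ℂ] K) {T : H →L[ℂ] H} (hT : T ∈ traceClass H)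
    (B : K →L[ℂ] H) : A ∘L T ∘L B ∈ traceClass K := by
  induction hT using traceClass_induction with
  | hS S hS =>
    rw [sandwich_eq]
    exact adjoint_comp_mem_traceClass (hS.comp_right _) (hS.comp_right _)
  | hadd T hT R hR h1 h2 =>
    simpa [ContinuousLinearMap.add_comp, ContinuousLinearMap.comp_add] using add_mem h1 h2
  | hsmul c T hT h =>
    simpa [ContinuousLinearMap.smul_comp, ContinuousLinearMap.comp_smul]
      using Submodule.smul_mem _ c h

theorem mul_mem_traceClass {T : H →L[ℂ] H} (hT : T ∈ traceClass H) (X : H →L[ℂ] H) :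
    T * X ∈ traceClass H :=
  comp_comp_mem_traceClass (.id ℂ H) hT X

theorem trace_adjoint_comp_self_mul {S : H →L[ℂ] H} (hS : IsHilbertSchmidt S) (X : H →L[ℂ] H) :
    trace ((adjoint S ∘L S) * X) = trace (S ∘L X ∘L adjoint S) := by
  have h := trace_adjoint_comp hS (hS.comp_right X)
  rwa [ContinuousLinearMap.comp_assoc, ← ContinuousLinearMap.comp_assoc] at h

/-- Cyclicity of the trace. -/
theorem trace_comp_comp (A : H →L[ℂ] K) {T : H →L[ℂ] H} (hT : T ∈ traceClass H)
    (B : K →L[ℂ] H) : trace (A ∘L T ∘L B) = trace (T * (B ∘L A)) := by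
  induction hT using traceClass_induction with
  | hS S hS =>
    rw [sandwich_eq, trace_adjoint_comp_self_mul hS,
      trace_adjoint_comp (hS.comp_right _) (hS.comp_right _)]
    simp [ContinuousLinearMap.adjoint_comp, ContinuousLinearMap.comp_assoc]
  | hadd T hT R hR h1 h2 =>
    rw [add_mul, trace_add (mul_mem_traceClass hT _) (mul_mem_traceClass hR _), ← h1, ← h2,
      ← trace_add (comp_comp_mem_traceClass A hT B) (comp_comp_mem_traceClass A hR B)]
    simp [ContinuousLinearMap.add_comp, ContinuousLinearMap.comp_add]
  | hsmul c T hT h =>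
    rw [smul_mul_assoc, trace_smul _ (mul_mem_traceClass hT _), ← h,
      ← trace_smul _ (comp_comp_mem_traceClass A hT B)]
    simp [ContinuousLinearMap.smul_comp]

theorem exists_hilbertSchmidt {T : H →L[ℂ] H} (hT : T ∈ traceClass H) (h : 0 ≤ T) :
    ∃ S : H →L[ℂ] H, IsHilbertSchmidt S ∧ T = adjoint S ∘L S := by
  have h1 := exists_eq_adjoint_comp_self h
  refine ⟨_, isHilbertSchmidt_of_summable ?_, h1⟩
  rw [← h1]
  exact (hasSum_trace (basis H) hT).summable

/-- Cyclicity turns the trace into a sum of expectations of X in the vectors S* bᵢ. Positivity, the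
norm bound and the approximation by rank one operators all rest on it. -/
theorem hasSum_trace_adjoint_comp_self_mul (b : HilbertBasis ι ℂ H) {S : H →L[ℂ] H}
    (hS : IsHilbertSchmidt S) (X : H →L[ℂ] H) :
    HasSum (fun i => inner ℂ (adjoint S (b i)) (X (adjoint S (b i))))
      (trace ((adjoint S ∘L S) * X)) := by
  rw [trace_adjoint_comp_self_mul hS]
  have hm : S ∘L X ∘L adjoint S ∈ traceClass H := by
    have h := adjoint_comp_mem_traceClass hS.adjoint (hS.adjoint.comp_left X)
    rwa [ContinuousLinearMap.adjoint_adjoint] at h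
  refine (hasSum_trace b hm).congr_fun fun i => ?_
  rw [ContinuousLinearMap.comp_apply, ContinuousLinearMap.comp_apply,
    ContinuousLinearMap.adjoint_inner_left]

theorem trace_mul_nonneg {T X : H →L[ℂ] H} (hT : T ∈ traceClass H) (h : 0 ≤ T) (hX : 0 ≤ X) :
    0 ≤ trace (T * X) := by
  obtain ⟨S, hS, rfl⟩ := exists_hilbertSchmidt hT h
  exact (hasSum_trace_adjoint_comp_self_mul (basis H) hS X).nonneg
    fun i => nonneg_iff_inner.1 hX _

theorem hasSum_trace_adjoint_comp_self (b : HilbertBasis ι ℂ H) {S : H →L[ℂ] H}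
    (hS : IsHilbertSchmidt S) :
    HasSum (fun i => ‖adjoint S (b i)‖ ^ 2) (trace (adjoint S ∘L S)).re := by
  have h := Complex.hasSum_re (hasSum_trace_adjoint_comp_self_mul b hS 1)
  rw [mul_one] at h
  refine h.congr_fun fun i => ?_
  exact (inner_self_eq_norm_sq (𝕜 := ℂ) _).symm

theorem norm_trace_mul_le {T : H →L[ℂ] H} (hT : T ∈ traceClass H) (h : 0 ≤ T)
    (X : H →L[ℂ] H) : ‖trace (T * X)‖ ≤ ‖X‖ * (trace T).re := by
  obtain ⟨S, hS, rfl⟩ := exists_hilbertSchmidt hT h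
  rw [← (hasSum_trace_adjoint_comp_self_mul (basis H) hS X).tsum_eq]
  refine tsum_of_norm_bounded ((hasSum_trace_adjoint_comp_self (basis H) hS).mul_left ‖X‖)
    fun i => ?_
  refine (norm_inner_le_norm _ _).trans ?_
  have h1 := X.le_opNorm (adjoint S (basis H i))
  nlinarith [norm_nonneg (adjoint S (basis H i))]

theorem eq_zero_of_trace_eq_zero {T : H →L[ℂ] H} (hT : T ∈ traceClass H) (h : 0 ≤ T)
    (h0 : trace T = 0) : T = 0 := by
  obtain ⟨S, hS, rfl⟩ := exists_hilbertSchmidt hT h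
  ext x
  refine ext_inner_left ℂ fun y => ?_
  have h1 : ∀ X, trace ((adjoint S ∘L S) * X) = 0 := fun X => by
    have := norm_trace_mul_le hT h X
    rw [h0] at this
    simpa using this
  have h2 := hasSum_trace_adjoint_comp_self (basis H) hS
  rw [h0, Complex.zero_re, hasSum_zero_iff_of_nonneg (fun _ => by positivity)] at h2
  -- The trace is the sum of the ‖S* eᵢ‖², so S* kills the basis and all coefficients ⟨eᵢ, Sz⟩ = ⟨S*
  -- eᵢ, z⟩ vanish.
  have h3 : ∀ i, adjoint S (basis H i) = 0 := fun i => by simpa using congrFun h2 i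
  have h4 : ∀ z, S z = 0 := fun z => by
    rw [← norm_eq_zero, ← sq_eq_zero_iff, ← (hasSum_norm_inner_sq (basis H) (S z)).tsum_eq]
    simp_rw [← ContinuousLinearMap.adjoint_inner_left, h3]
    simp
  simp [h4]

theorem rankOne_self_mem_traceClass (x : H) : InnerProductSpace.rankOne ℂ x x ∈ traceClass H := by
  refine Submodule.subset_span ⟨nonneg_iff_inner.2 fun y => ?_, ?_⟩
  · rw [InnerProductSpace.rankOne_apply, inner_smul_right, ← inner_conj_symm x y, mul_comm]
    exact mul_star_self_nonneg _
  · refine ((basis H).summable_inner_mul_inner x x).congr fun i => ?_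
    rw [InnerProductSpace.rankOne_apply, inner_smul_right]

theorem rankOne_mem_traceClass (x y : H) : InnerProductSpace.rankOne ℂ x y ∈ traceClass H := by
  by_cases hx : x = 0
  · simp [hx]
  have h := mul_mem_traceClass (rankOne_self_mem_traceClass x) (InnerProductSpace.rankOne ℂ x y)
  have e : InnerProductSpace.rankOne ℂ x x * InnerProductSpace.rankOne ℂ x y
      = inner ℂ x x • InnerProductSpace.rankOne ℂ x y := by
    ext z
    simp [smul_smul, mul_comm]
  rw [e] at h
  exact (Submodule.smul_mem_iff _ (inner_self_ne_zero.2 hx)).1 h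

theorem trace_rankOne_mul (x y : H) (X : H →L[ℂ] H) :
    trace (InnerProductSpace.rankOne ℂ x y * X) = inner ℂ y (X x) := by
  have h := hasSum_trace (basis H) (mul_mem_traceClass (rankOne_mem_traceClass x y) X)
  refine h.unique ?_
  rw [← ContinuousLinearMap.adjoint_inner_left]
  refine ((basis H).hasSum_inner_mul_inner _ _).congr_fun fun i => ?_
  rw [mul_apply_eq_comp, InnerProductSpace.rankOne_apply, inner_smul_right,
    ContinuousLinearMap.adjoint_inner_left]

theorem linearMap_ext_adjoint_comp_self {M : Type*} [AddCommGroup M] [Module ℂ M]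
    {f g : traceClass H →ₗ[ℂ] M} (h : ∀ (S : H →L[ℂ] H) (hS : IsHilbertSchmidt S),
      f ⟨_, adjoint_comp_self_mem_traceClass hS⟩ = g ⟨_, adjoint_comp_self_mem_traceClass hS⟩) :
    f = g := by
  ext ⟨T, hT⟩
  induction hT using traceClass_induction with
  | hS S hS => exact h S hS
  | hadd T hT R hR h1 h2 =>
    exact (map_add f ⟨T, hT⟩ ⟨R, hR⟩).trans
      ((congrArg₂ (· + ·) h1 h2).trans (map_add g ⟨T, hT⟩ ⟨R, hR⟩).symm)
  | hsmul c T hT h1 =>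
    exact (map_smul f c ⟨T, hT⟩).trans
      ((congrArg (c • ·) h1).trans (map_smul g c ⟨T, hT⟩).symm)

/-- Linear maps on the trace class operators are determined by their values on states. -/
theorem linearMap_ext_states {M : Type*} [AddCommGroup M] [Module ℂ M]
    {f g : traceClass H →ₗ[ℂ] M} (h : ∀ ρ, IsState ρ → f ρ = g ρ) : f = g := by
  refine linearMap_ext_adjoint_comp_self fun S hS => ?_
  have hm := adjoint_comp_self_mem_traceClass hS
  have hpos := adjoint_comp_self_nonneg S
  -- Normalizing by the trace gives a state unless the trace is zero, and then the operator itself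
  -- is zero.
  by_cases h0 : trace (adjoint S ∘L S) = 0
  · have : (⟨_, hm⟩ : traceClass H) = 0 := Subtype.ext (eq_zero_of_trace_eq_zero hm hpos h0)
    rw [this, map_zero, map_zero]
  · have h1 : 0 ≤ trace (adjoint S ∘L S) := by
      simpa using trace_mul_nonneg hm hpos zero_le_one
    have hst : IsState ((trace (adjoint S ∘L S))⁻¹ • (⟨_, hm⟩ : traceClass H)) := by
      refine ⟨nonneg_iff_inner.2 fun x => ?_, ?_⟩
      · simp only [Submodule.coe_smul, smul_apply, inner_smul_right]
        exact mul_nonneg (inv_nonneg.2 h1) (nonneg_iff_inner.1 hpos x)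
      · rw [Submodule.coe_smul, trace_smul _ hm, inv_mul_cancel₀ h0]
    have := h _ hst
    rw [map_smul, map_smul] at this
    exact smul_right_injective M (inv_ne_zero h0) this

end TraceClass

/-! ### Trace functionals and the existence of dual maps -/

section Dual

variable {H : Type*} [NormedAddCommGroup H] [InnerProductSpace ℂ H] [CompleteSpace H]
variable {K : Type*} [NormedAddCommGroup K] [InnerProductSpace ℂ K] [CompleteSpace K]

open ContinuousLinearMap (adjoint)

/-- The functional `T ↦ tr(T X)` on the trace class operators. -/
noncomputable def traceMul (X : H →L[ℂ] H) : traceClass H →ₗ[ℂ] ℂ where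
  toFun T := trace ((T : H →L[ℂ] H) * X)
  map_add' T R := by
    rw [Submodule.coe_add, add_mul,
      trace_add (mul_mem_traceClass T.2 X) (mul_mem_traceClass R.2 X)]
  map_smul' c T := by
    rw [Submodule.coe_smul, smul_mul_assoc, trace_smul _ (mul_mem_traceClass T.2 X)]
    rfl

theorem traceMul_apply (X : H →L[ℂ] H) (T : traceClass H) :
    traceMul X T = trace ((T : H →L[ℂ] H) * X) := rfl

theorem traceMul_add (X Y : H →L[ℂ] H) : traceMul (X + Y) = traceMul X + traceMul Y := by
  ext T
  simp only [LinearMap.add_apply, traceMul_apply, mul_add]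
  exact trace_add (mul_mem_traceClass T.2 X) (mul_mem_traceClass T.2 Y)

theorem traceMul_smul (c : ℂ) (X : H →L[ℂ] H) : traceMul (c • X) = c • traceMul X := by
  ext T
  simp only [LinearMap.smul_apply, traceMul_apply, mul_smul_comm, smul_eq_mul]
  exact trace_smul c (mul_mem_traceClass T.2 X)

theorem traceMul_sum {ι : Type*} (s : Finset ι) (X : ι → H →L[ℂ] H) :
    traceMul (∑ i ∈ s, X i) = ∑ i ∈ s, traceMul (X i) :=
  map_sum ({ toFun := traceMul, map_add' := traceMul_add, map_smul' := traceMul_smul } :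
    (H →L[ℂ] H) →ₗ[ℂ] (traceClass H →ₗ[ℂ] ℂ)) X s

theorem traceMul_one (T : traceClass H) : traceMul 1 T = trace (T : H →L[ℂ] H) := by
  rw [traceMul_apply, mul_one]

/-- The rank one operator `|x⟩⟨y|` as a trace class operator. -/
noncomputable def rankOneTC (x y : H) : traceClass H :=
  ⟨InnerProductSpace.rankOne ℂ x y, rankOne_mem_traceClass x y⟩

theorem traceMul_rankOneTC (X : H →L[ℂ] H) (x y : H) :
    traceMul X (rankOneTC x y) = inner ℂ y (X x) :=
  trace_rankOne_mul x y X

theorem ext_traceMul {X Y : H →L[ℂ] H} (h : traceMul X = traceMul Y) : X = Y := by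
  ext x
  refine ext_inner_left ℂ fun y => ?_
  rw [← traceMul_rankOneTC, h, traceMul_rankOneTC]

theorem rankOneTC_self_nonneg (x : H) : 0 ≤ (rankOneTC x x : H →L[ℂ] H) :=
  (ContinuousLinearMap.nonneg_iff_isPositive _).2 (InnerProductSpace.isPositive_rankOne_self x)

theorem trace_rankOneTC (x y : H) : trace (rankOneTC x y : H →L[ℂ] H) = inner ℂ y x := by
  rw [← traceMul_one, traceMul_rankOneTC]
  rfl

/-- A functional that is bounded by the trace on positive operators. -/
def TraceBounded (f : traceClass H →ₗ[ℂ] ℂ) (C : ℝ) : Prop :=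
  ∀ R : traceClass H, 0 ≤ (R : H →L[ℂ] H) → ‖f R‖ ≤ C * (trace (R : H →L[ℂ] H)).re

theorem rankOneTC_polarization (x y : H) :
    rankOneTC x y = (1 / 4 : ℂ) • (rankOneTC (x + y) (x + y)
      + (-1 : ℂ) • rankOneTC (x - y) (x - y)
      + Complex.I • rankOneTC (x + Complex.I • y) (x + Complex.I • y)
      + (-Complex.I) • rankOneTC (x - Complex.I • y) (x - Complex.I • y)) := by
  apply Subtype.ext
  ext z
  simp only [rankOneTC, Submodule.coe_smul, Submodule.coe_add, smul_apply, add_apply,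
    InnerProductSpace.rankOne_apply, inner_add_left, inner_sub_left, inner_smul_left,
    Complex.conj_I]
  match_scalars <;> ring_nf <;> simp [Complex.I_sq]; ring

namespace TraceBounded

variable {f : traceClass H →ₗ[ℂ] ℂ} {C : ℝ}

theorem norm_self_le (h : TraceBounded f C) (x : H) : ‖f (rankOneTC x x)‖ ≤ C * ‖x‖ ^ 2 := by
  have := h _ (rankOneTC_self_nonneg x)
  rw [trace_rankOneTC] at this
  rwa [← inner_self_eq_norm_sq (𝕜 := ℂ) x]

theorem norm_unit_le (h : TraceBounded f C) (x y : H) (hx : ‖x‖ = 1) (hy : ‖y‖ = 1) :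
    ‖f (rankOneTC x y)‖ ≤ 2 * C := by
  rw [rankOneTC_polarization]
  simp only [map_add, map_smul, smul_eq_mul]
  have h1 := h.norm_self_le (x + y)
  have h2 := h.norm_self_le (x - y)
  have h3 := h.norm_self_le (x + Complex.I • y)
  have h4 := h.norm_self_le (x - Complex.I • y)
  have p1 := parallelogram_law_with_norm ℂ x y
  have p2 := parallelogram_law_with_norm ℂ x (Complex.I • y)
  rw [norm_smul, Complex.norm_I, one_mul] at p2
  rw [hx, hy] at p1 p2
  -- For unit vectors each pair of squared norms in the polarization sums to 4, whence the constant
  -- (1/4)(4C + 4C) = 2C.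
  have q1 : ‖x + y‖ ^ 2 + ‖x - y‖ ^ 2 = 4 := by nlinarith
  have q2 : ‖x + Complex.I • y‖ ^ 2 + ‖x - Complex.I • y‖ ^ 2 = 4 := by nlinarith
  calc _ ≤ 1 / 4 * (C * ‖x + y‖ ^ 2 + C * ‖x - y‖ ^ 2 + C * ‖x + Complex.I • y‖ ^ 2
        + C * ‖x - Complex.I • y‖ ^ 2) := by
        rw [norm_mul]
        have : ‖(1 / 4 : ℂ)‖ = 1 / 4 := by norm_num
        rw [this]
        refine mul_le_mul_of_nonneg_left ?_ (by norm_num)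
        refine (norm_add_le _ _).trans (add_le_add ((norm_add_le _ _).trans
          (add_le_add ((norm_add_le _ _).trans (add_le_add h1 ?_)) ?_)) ?_)
        · simpa using h2
        · simpa using h3
        · simpa using h4
    _ = 1 / 4 * (C * (‖x + y‖ ^ 2 + ‖x - y‖ ^ 2) + C * (‖x + Complex.I • y‖ ^ 2
        + ‖x - Complex.I • y‖ ^ 2)) := by ring
    _ = 2 * C := by rw [q1, q2]; ring

theorem rankOneTC_smul_smul (a b : ℝ) (x y : H) :
    rankOneTC ((a : ℂ) • x) ((b : ℂ) • y) = ((a * b : ℝ) : ℂ) • rankOneTC x y := by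
  apply Subtype.ext
  ext z
  simp only [rankOneTC, Submodule.coe_smul, smul_apply, InnerProductSpace.rankOne_apply,
    inner_smul_left, smul_smul, Complex.conj_ofReal, Complex.ofReal_mul]
  congr 1
  ring

/-- Polarization alone bounds by a multiple of ‖x‖² + ‖y‖²; rescaling to unit vectors yields the
product of the norms. -/
theorem norm_le (h : TraceBounded f C) (x y : H) :
    ‖f (rankOneTC x y)‖ ≤ 2 * C * ‖x‖ * ‖y‖ := by
  rcases eq_or_ne x 0 with rfl | hx
  · have : rankOneTC (0 : H) y = 0 := Subtype.ext (by simp [rankOneTC])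
    simp [this]
  rcases eq_or_ne y 0 with rfl | hy
  · have : rankOneTC x (0 : H) = 0 := Subtype.ext (by simp [rankOneTC])
    simp [this]
  have hx' := norm_ne_zero_iff.2 hx
  have hy' := norm_ne_zero_iff.2 hy
  have e := rankOneTC_smul_smul ‖x‖ ‖y‖ (((‖x‖⁻¹ : ℝ) : ℂ) • x) (((‖y‖⁻¹ : ℝ) : ℂ) • y)
  rw [smul_smul, smul_smul, ← Complex.ofReal_mul, ← Complex.ofReal_mul, mul_inv_cancel₀ hx',
    mul_inv_cancel₀ hy', Complex.ofReal_one, one_smul, one_smul] at e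
  have hu := h.norm_unit_le (((‖x‖⁻¹ : ℝ) : ℂ) • x) (((‖y‖⁻¹ : ℝ) : ℂ) • y)
    (by simp [norm_smul, hx']) (by simp [norm_smul, hy'])
  rw [e, map_smul, norm_smul, Complex.norm_real, Real.norm_of_nonneg (by positivity)]
  calc _ ≤ ‖x‖ * ‖y‖ * (2 * C) := by gcongr
    _ = _ := by ring

/-- Every trace bounded functional is represented by a bounded operator on rank one operators. -/
theorem exists_operator (h : TraceBounded f C) :
    ∃ D : H →L[ℂ] H, ∀ x y, f (rankOneTC x y) = inner ℂ y (D x) := by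
  let g : H →ₗ⋆[ℂ] H →ₗ[ℂ] ℂ := LinearMap.mk₂'ₛₗ (starRingEnd ℂ) (RingHom.id ℂ)
    (fun y x => f (rankOneTC x y))
    (fun y y' x => by
      rw [← map_add]; congr 1; apply Subtype.ext; simp [rankOneTC])
    (fun c y x => by
      rw [← map_smul]; congr 1; apply Subtype.ext; simp [rankOneTC])
    (fun y x x' => by
      rw [← map_add]; congr 1; apply Subtype.ext; simp [rankOneTC])
    (fun c y x => by
      rw [← map_smul]; congr 1; apply Subtype.ext; simp [rankOneTC])
  let G : H →L⋆[ℂ] H →L[ℂ] ℂ := g.mkContinuous₂ (2 * C) fun y x => by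
    have := h.norm_le x y
    calc _ ≤ 2 * C * ‖x‖ * ‖y‖ := this
      _ = _ := by ring
  -- The Riesz operator of `G` acts on y, in the first slot of the inner product; its adjoint acts
  -- on x.
  refine ⟨adjoint (InnerProductSpace.continuousLinearMapOfBilin G), fun x y => ?_⟩
  rw [ContinuousLinearMap.adjoint_inner_right, InnerProductSpace.continuousLinearMapOfBilin_apply]
  rfl

/-- This is Bessel's inequality for S x. -/
theorem sub_sum_nonneg {ι : Type*} (b : HilbertBasis ι ℂ H) (S : H →L[ℂ] H) (F : Finset ι) :
    0 ≤ adjoint S ∘L S - ∑ i ∈ F,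
      InnerProductSpace.rankOne ℂ (adjoint S (b i)) (adjoint S (b i)) := by
  refine nonneg_iff_inner.2 fun x => ?_
  have h1 : ∀ i, inner ℂ x ((InnerProductSpace.rankOne ℂ (adjoint S (b i)) (adjoint S (b i))) x)
      = ((‖inner ℂ (b i) (S x)‖ ^ 2 : ℝ) : ℂ) := fun i => by
    rw [InnerProductSpace.rankOne_apply, inner_smul_right, ← inner_conj_symm x,
      ContinuousLinearMap.adjoint_inner_left, Complex.mul_conj, Complex.normSq_eq_norm_sq]
  rw [sub_apply, inner_sub_right, inner_adjoint_comp_self, sum_apply, inner_sum]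
  simp_rw [h1]
  rw [← Complex.ofReal_sum, ← Complex.ofReal_sub]
  exact Complex.zero_le_real.2 (sub_nonneg.2 (b.orthonormal.sum_inner_products_le (S x)))

/-- For T = S*S with partial sums R_F of |S* bᵢ⟩⟨S* bᵢ|, the remainder T - R_F is positive, so |f(T
- R_F)| ≤ C (tr T - tr R_F) → 0, while f(R_F) → tr(TD). Trace boundedness on positive operators thus
replaces continuity of f. -/
theorem eq_traceMul (h : TraceBounded f C) {D : H →L[ℂ] H}
    (hD : ∀ x y, f (rankOneTC x y) = inner ℂ y (D x)) : f = traceMul D := by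
  refine linearMap_ext_adjoint_comp_self fun S hS => ?_
  let b := basis H
  let T : traceClass H := ⟨_, adjoint_comp_self_mem_traceClass hS⟩
  let R : Finset (basisIndex H) → traceClass H := fun F =>
    ∑ i ∈ F, rankOneTC (adjoint S (b i)) (adjoint S (b i))
  have h1 : Filter.Tendsto (fun F => f (R F)) Filter.atTop (nhds (traceMul D T)) := by
    refine Filter.Tendsto.congr (fun F => ?_) (hasSum_trace_adjoint_comp_self_mul b hS D)
    simp only [R, map_sum, hD]
  have h2 : Filter.Tendsto (fun F => (traceLinear H (R F)).re) Filter.atTop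
      (nhds (traceLinear H T).re) := by
    refine Filter.Tendsto.congr (fun F => ?_) (hasSum_trace_adjoint_comp_self b hS)
    simp only [R, map_sum, Complex.re_sum]
    refine Finset.sum_congr rfl fun i _ => ?_
    rw [← inner_self_eq_norm_sq (𝕜 := ℂ), ← trace_rankOneTC]
    rfl
  have h3 : Filter.Tendsto (fun F => f T - f (R F)) Filter.atTop (nhds 0) := by
    have h4 := (h2.const_sub (traceLinear H T).re).const_mul C
    rw [sub_self, mul_zero] at h4
    refine squeeze_zero_norm (fun F => ?_) h4
    rw [← map_sub, ← Complex.sub_re, ← map_sub]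
    refine h _ ?_
    simp only [Submodule.coe_sub, R, Submodule.coe_sum]
    exact sub_sum_nonneg b S F
  exact sub_eq_zero.1 (tendsto_nhds_unique h3 (h1.const_sub (f T))).symm

end TraceBounded

theorem isDualMap_iff {Φ : traceClass H →ₗ[ℂ] traceClass K}
    {D : (K →L[ℂ] K) →ₗ[ℂ] (H →L[ℂ] H)} :
    IsDualMap Φ D ↔ ∀ X, traceMul (D X) = traceMul X ∘ₗ Φ :=
  ⟨fun h X => LinearMap.ext fun T => h T X, fun h T X => LinearMap.congr_fun (h X) T⟩

theorem IsCompletelyPositive.nonneg {Φ : traceClass H →ₗ[ℂ] traceClass K}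
    (h : IsCompletelyPositive Φ) {T : traceClass H} (hT : 0 ≤ (T : H →L[ℂ] H)) :
    0 ≤ (Φ T : K →L[ℂ] K) := by
  refine nonneg_iff_inner.2 fun x => ?_
  have := h 1 (fun _ _ => T) (fun ξ => by simpa using nonneg_iff_inner.1 hT (ξ 0)) (fun _ => x)
  simpa using this

/-- A completely positive map whose trace functional is given by a bounded operator has a
unique dual map. -/
theorem existsUnique_isDualMap {Φ : traceClass H →ₗ[ℂ] traceClass K}
    (hΦ : IsCompletelyPositive Φ) (E : H →L[ℂ] H)
    (hE : ∀ T : traceClass H, trace (Φ T : K →L[ℂ] K) = trace ((T : H →L[ℂ] H) * E)) :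
    ∃! D, IsDualMap Φ D := by
  have hb : ∀ X : K →L[ℂ] K, TraceBounded (traceMul X ∘ₗ Φ) (‖X‖ * ‖E‖) := by
    intro X R hR
    refine (norm_trace_mul_le (Φ R).2 (hΦ.nonneg hR) X).trans ?_
    rw [mul_assoc]
    refine mul_le_mul_of_nonneg_left ?_ (norm_nonneg X)
    refine (Complex.re_le_norm _).trans ?_
    rw [hE]
    exact norm_trace_mul_le R.2 hR E
  have hex : ∀ X : K →L[ℂ] K, ∃ D : H →L[ℂ] H, traceMul D = traceMul X ∘ₗ Φ := fun X => by
    obtain ⟨D, hD⟩ := (hb X).exists_operator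
    exact ⟨D, ((hb X).eq_traceMul hD).symm⟩
  choose D hD using hex
  -- Linearity and uniqueness both follow from the injectivity of `traceMul`.
  refine ⟨⟨⟨D, fun X Y => ext_traceMul ?_⟩, fun c X => ext_traceMul ?_⟩,
    isDualMap_iff.2 hD, fun D' hD' => LinearMap.ext fun X => ext_traceMul ?_⟩
  · rw [hD, traceMul_add, traceMul_add, hD, hD, LinearMap.add_comp]
  · change traceMul (D (c • X)) = traceMul (c • D X)
    rw [hD, traceMul_smul, traceMul_smul, hD, LinearMap.smul_comp]
  · rw [isDualMap_iff.1 hD' X]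
    exact (hD X).symm

theorem IsDualMap.nonneg {Φ : traceClass H →ₗ[ℂ] traceClass K}
    {D : (K →L[ℂ] K) →ₗ[ℂ] (H →L[ℂ] H)} (hD : IsDualMap Φ D) (hΦ : IsCompletelyPositive Φ)
    {X : K →L[ℂ] K} (hX : 0 ≤ X) : 0 ≤ D X := by
  refine nonneg_iff_inner.2 fun x => ?_
  rw [← traceMul_rankOneTC, isDualMap_iff.1 hD]
  exact trace_mul_nonneg (Φ _).2 (hΦ.nonneg (rankOneTC_self_nonneg x)) hX

end Dual

/-! ### Operators and bases on the Hilbert space tensor product -/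

section Tensor

variable {K : Type*} [NormedAddCommGroup K] [InnerProductSpace ℂ K]
variable {H : Type*} [NormedAddCommGroup H] [InnerProductSpace ℂ H]

open ContinuousLinearMap (adjoint)

/-- The elementary tensor `x ⊗ y` in the Hilbert space tensor product. -/
noncomputable def elemTensor (x : K) (y : H) : HilbertTensor K H := ((x ⊗ₜ[ℂ] y : K ⊗[ℂ] H))

theorem tensorOp_elemTensor (S : K →L[ℂ] K) (T : H →L[ℂ] H) (x : K) (y : H) :
    tensorOp S T (elemTensor x y) = elemTensor (S x) (T y) := by
  unfold tensorOp elemTensor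
  rw [ContinuousLinearMap.completion_apply_coe]
  rfl

theorem inner_elemTensor (x x' : K) (y y' : H) :
    inner ℂ (elemTensor x y) (elemTensor x' y') = inner ℂ x x' * inner ℂ y y' := by
  unfold elemTensor
  rw [UniformSpace.Completion.inner_coe, TensorProduct.inner_tmul]

theorem hilbertTensor_ext {M : Type*} [NormedAddCommGroup M] [NormedSpace ℂ M]
    {f g : HilbertTensor K H →L[ℂ] M}
    (h : ∀ x y, f (elemTensor x y) = g (elemTensor x y)) : f = g := by
  ext z
  induction z using UniformSpace.Completion.induction_on with
  | hp => exact isClosed_eq f.continuous g.continuous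
  | ih a =>
    induction a using TensorProduct.induction_on with
    | zero => rw [UniformSpace.Completion.coe_zero, map_zero, map_zero]
    | tmul x y => exact h x y
    | add a b ha hb => rw [UniformSpace.Completion.coe_add, map_add, map_add, ha, hb]

theorem hilbertTensor_ext_vec {u v : HilbertTensor K H}
    (h : ∀ x y, inner ℂ u (elemTensor x y) = inner ℂ v (elemTensor x y)) : u = v := by
  have : innerSL ℂ u = innerSL ℂ v := hilbertTensor_ext h
  exact ext_inner_right ℂ fun w => DFunLike.congr_fun this w

theorem tensorOp_mul (S S' : K →L[ℂ] K) (T T' : H →L[ℂ] H) :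
    tensorOp S T * tensorOp S' T' = tensorOp (S * S') (T * T') :=
  hilbertTensor_ext fun x y => by
    simp only [mul_apply_eq_comp, tensorOp_elemTensor]

theorem tensorOp_sum_left {ι : Type*} (s : Finset ι) (S : ι → K →L[ℂ] K) (T : H →L[ℂ] H) :
    tensorOp (∑ i ∈ s, S i) T = ∑ i ∈ s, tensorOp (S i) T :=
  hilbertTensor_ext fun x y => by
    simp only [tensorOp_elemTensor, sum_apply]
    simp only [elemTensor, TensorProduct.sum_tmul]
    exact map_sum (UniformSpace.Completion.toComplₗᵢ (𝕜 := ℂ)) _ _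

theorem tensorOp_sum_right {ι : Type*} (s : Finset ι) (S : K →L[ℂ] K) (T : ι → H →L[ℂ] H) :
    tensorOp S (∑ i ∈ s, T i) = ∑ i ∈ s, tensorOp S (T i) :=
  hilbertTensor_ext fun x y => by
    simp only [tensorOp_elemTensor, sum_apply]
    simp only [elemTensor, TensorProduct.tmul_sum]
    exact map_sum (UniformSpace.Completion.toComplₗᵢ (𝕜 := ℂ)) _ _

theorem adjoint_tensorOp [CompleteSpace K] [CompleteSpace H] (S : K →L[ℂ] K) (T : H →L[ℂ] H) :
    adjoint (tensorOp S T) = tensorOp (adjoint S) (adjoint T) := by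
  refine hilbertTensor_ext fun x y => hilbertTensor_ext_vec fun x' y' => ?_
  rw [ContinuousLinearMap.adjoint_inner_left, tensorOp_elemTensor, tensorOp_elemTensor,
    inner_elemTensor, inner_elemTensor, ContinuousLinearMap.adjoint_inner_left,
    ContinuousLinearMap.adjoint_inner_left]

/-- With S = S'*S' and T = T'*T' the tensor product is (S' ⊗ T')*(S' ⊗ T'). -/
theorem tensorOp_nonneg [CompleteSpace K] [CompleteSpace H] {S : K →L[ℂ] K} {T : H →L[ℂ] H}
    (hS : 0 ≤ S) (hT : 0 ≤ T) : 0 ≤ tensorOp S T := by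
  obtain ⟨S', rfl⟩ : ∃ S', S = adjoint S' ∘L S' := ⟨_, exists_eq_adjoint_comp_self hS⟩
  obtain ⟨T', rfl⟩ : ∃ T', T = adjoint T' ∘L T' := ⟨_, exists_eq_adjoint_comp_self hT⟩
  have h := tensorOp_mul (adjoint S') S' (adjoint T') T'
  rw [← adjoint_tensorOp] at h
  refine le_of_le_of_eq ?_ h
  exact adjoint_comp_self_nonneg _

theorem eq_zero_of_hilbertBasis {ι : Type*} {E F : Type*} [NormedAddCommGroup E]
    [InnerProductSpace ℂ E] [NormedAddCommGroup F] [NormedSpace ℂ F] (b : HilbertBasis ι ℂ E)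
    {f : E →L[ℂ] F} (hf : ∀ i, f (b i) = 0) : f = 0 := by
  ext x
  have h := (b.hasSum_repr x).mapL f
  simp only [map_smul, hf, smul_zero] at h
  exact (hasSum_zero.unique h).symm

theorem span_elemTensor_orthogonal_eq_bot {ι κ : Type*} (b : HilbertBasis ι ℂ K) (c : HilbertBasis κ ℂ H) :
    (Submodule.span ℂ (Set.range fun p : ι × κ => elemTensor (b p.1) (c p.2)))ᗮ = ⊥ := by
  rw [Submodule.eq_bot_iff]
  intro z hz
  have h0 : ∀ i j, inner ℂ z (elemTensor (b i) (c j)) = 0 := fun i j =>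
    Submodule.inner_left_of_mem_orthogonal
      (Submodule.subset_span (Set.mem_range_self (i, j))) hz
  -- The bounded bilinear form (x, y) ↦ ⟨z, x ⊗ y⟩ vanishes on pairs of basis vectors, hence
  -- identically, one variable at a time.
  let B : K →L[ℂ] H →L[ℂ] ℂ :=
    (ContinuousLinearMap.compL ℂ H (HilbertTensor K H) ℂ (innerSL ℂ z)) ∘L
      (ContinuousLinearMap.compL ℂ H (K ⊗[ℂ] H) (HilbertTensor K H)
        UniformSpace.Completion.toComplL) ∘L TensorProduct.mkL ℂ K H
  have hB : ∀ x y, B x y = inner ℂ z (elemTensor x y) := fun x y => rfl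
  have hB0 : B = 0 := eq_zero_of_hilbertBasis b fun i => eq_zero_of_hilbertBasis c fun j => h0 i j
  refine hilbertTensor_ext_vec fun x y => ?_
  rw [← hB, hB0]
  simp

/-- The product basis of the Hilbert space tensor product. -/
noncomputable def tensorBasis {ι κ : Type*} (b : HilbertBasis ι ℂ K) (c : HilbertBasis κ ℂ H) :
    HilbertBasis (ι × κ) ℂ (HilbertTensor K H) :=
  HilbertBasis.mkOfOrthogonalEqBot (v := fun p : ι × κ => elemTensor (b p.1) (c p.2)) (by
    classical
    rw [orthonormal_iff_ite]
    rintro ⟨i, j⟩ ⟨i', j'⟩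
    rw [inner_elemTensor, orthonormal_iff_ite.1 b.orthonormal, orthonormal_iff_ite.1 c.orthonormal]
    simp [← ite_and, and_comm]) (span_elemTensor_orthogonal_eq_bot b c)

theorem tensorBasis_apply {ι κ : Type*} (b : HilbertBasis ι ℂ K) (c : HilbertBasis κ ℂ H)
    (p : ι × κ) : tensorBasis b c p = elemTensor (b p.1) (c p.2) := by
  rw [tensorBasis, HilbertBasis.coe_mkOfOrthogonalEqBot]

end Tensor

/-! ### The partial trace -/

section PartialTrace

variable {K : Type*} [NormedAddCommGroup K] [InnerProductSpace ℂ K] [CompleteSpace K]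
variable {H : Type*} [NormedAddCommGroup H] [InnerProductSpace ℂ H] [CompleteSpace H]

open ContinuousLinearMap (adjoint)

theorem norm_sq_le_tsum {ι : Type*} (c : HilbertBasis ι ℂ H) {S : H →L[ℂ] K}
    (hS : Summable fun i => ‖S (c i)‖ ^ 2) : ‖S‖ ^ 2 ≤ ∑' i, ‖S (c i)‖ ^ 2 := by
  have h0 : 0 ≤ ∑' i, ‖S (c i)‖ ^ 2 := tsum_nonneg fun _ => by positivity
  -- The adjoint has the same norm, and Parseval gives ‖S* y‖² = ∑ |⟨S cᵢ, y⟩|², to which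
  -- Cauchy–Schwarz applies termwise.
  rw [← LinearIsometryEquiv.norm_map adjoint S]
  refine (Real.le_sqrt (norm_nonneg _) h0).1
    (ContinuousLinearMap.opNorm_le_bound _ (Real.sqrt_nonneg _) fun y => ?_)
  refine le_of_sq_le_sq ?_ (by positivity)
  rw [mul_pow, Real.sq_sqrt h0, ← (hasSum_norm_inner_sq c _).tsum_eq, ← tsum_mul_right]
  refine (hasSum_norm_inner_sq c _).summable.tsum_le_tsum (fun i => ?_) (hS.mul_right _)
  rw [ContinuousLinearMap.adjoint_inner_right, ← mul_pow]
  exact pow_le_pow_left₀ (norm_nonneg _) (norm_inner_le_norm _ _) 2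

theorem summable_norm_comp_tensorLeft {M : Type*} [NormedAddCommGroup M] [InnerProductSpace ℂ M]
    [CompleteSpace M] {R : HilbertTensor K H →L[ℂ] M} (hR : IsHilbertSchmidt R) :
    Summable fun i => ‖R ∘L tensorLeft (H := H) (basis K i)‖ ^ 2 := by
  have h := hR.summable (tensorBasis (basis K) (basis H))
  simp_rw [tensorBasis_apply] at h
  refine Summable.of_nonneg_of_le (fun _ => by positivity) (fun i => ?_) h.prod
  exact norm_sq_le_tsum (basis H) (h.prod_factor i)

/-- For S = R*R the i-th term has norm ‖R Vᵢ‖², at most the part of the Hilbert–Schmidt sum of R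
over the vectors eᵢ ⊗ fⱼ with i fixed. -/
theorem summable_partialTrace {S : HilbertTensor K H →L[ℂ] HilbertTensor K H}
    (hS : S ∈ traceClass (HilbertTensor K H)) :
    Summable fun i => (adjoint (tensorLeft (H := H) (basis K i))) ∘L S ∘L
      (tensorLeft (H := H) (basis K i)) := by
  induction hS using traceClass_induction with
  | hS R hR =>
    refine Summable.of_norm_bounded (summable_norm_comp_tensorLeft hR) fun i => ?_
    have e : (adjoint (tensorLeft (H := H) (basis K i))) ∘L (adjoint R ∘L R) ∘L
        (tensorLeft (H := H) (basis K i)) = adjoint (R ∘L tensorLeft (H := H) (basis K i)) ∘L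
        (R ∘L tensorLeft (H := H) (basis K i)) := by
      rw [ContinuousLinearMap.adjoint_comp]
      rfl
    rw [e, ContinuousLinearMap.norm_adjoint_comp_self, sq]
  | hadd T hT R hR h1 h2 =>
    simpa only [ContinuousLinearMap.add_comp, ContinuousLinearMap.comp_add] using h1.add h2
  | hsmul c T hT h =>
    simpa only [ContinuousLinearMap.smul_comp, ContinuousLinearMap.comp_smul]
      using h.const_smul c

theorem hasSum_inner_partialTrace {S : HilbertTensor K H →L[ℂ] HilbertTensor K H}
    (hS : S ∈ traceClass (HilbertTensor K H)) (x y : H) :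
    HasSum (fun i => inner ℂ (elemTensor (basis K i) x) (S (elemTensor (basis K i) y)))
      (inner ℂ x (partialTrace S y)) := by
  have h := (summable_partialTrace hS).hasSum.mapL
    ((innerSL ℂ x) ∘L ContinuousLinearMap.apply ℂ H y)
  refine h.congr_fun fun i => ?_
  exact (ContinuousLinearMap.adjoint_inner_right (tensorLeft (basis K i)) x _).symm

theorem hasSum_trace_partialTrace {S : HilbertTensor K H →L[ℂ] HilbertTensor K H}
    (hS : S ∈ traceClass (HilbertTensor K H)) :
    HasSum (fun j => inner ℂ (basis H j) (partialTrace S (basis H j))) (trace S) := by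
  have h := hasSum_trace (tensorBasis (basis K) (basis H)) hS
  simp_rw [tensorBasis_apply] at h
  exact ((Equiv.prodComm _ _).hasSum_iff.2 h).prod_fiberwise
    fun j => hasSum_inner_partialTrace hS (basis H j) (basis H j)

theorem partialTrace_add {S T : HilbertTensor K H →L[ℂ] HilbertTensor K H}
    (hS : S ∈ traceClass (HilbertTensor K H)) (hT : T ∈ traceClass (HilbertTensor K H)) :
    partialTrace (S + T) = partialTrace S + partialTrace T := by
  unfold partialTrace
  rw [← (summable_partialTrace hS).tsum_add (summable_partialTrace hT)]
  simp only [ContinuousLinearMap.add_comp, ContinuousLinearMap.comp_add]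

theorem partialTrace_smul (c : ℂ) {S : HilbertTensor K H →L[ℂ] HilbertTensor K H}
    (hS : S ∈ traceClass (HilbertTensor K H)) :
    partialTrace (c • S) = c • partialTrace S := by
  unfold partialTrace
  rw [← (summable_partialTrace hS).tsum_const_smul]
  simp only [ContinuousLinearMap.smul_comp, ContinuousLinearMap.comp_smul]

theorem partialTrace_mem_traceClass {S : HilbertTensor K H →L[ℂ] HilbertTensor K H}
    (hS : S ∈ traceClass (HilbertTensor K H)) : partialTrace S ∈ traceClass H := by
  induction hS using traceClass_induction with
  | hS R hR =>
    have hm := adjoint_comp_self_mem_traceClass hR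
    refine Submodule.subset_span ⟨nonneg_iff_inner.2 fun x => ?_,
      (hasSum_trace_partialTrace hm).summable⟩
    exact (hasSum_inner_partialTrace hm x x).nonneg fun i =>
      nonneg_iff_inner.1 (adjoint_comp_self_nonneg R) _
  | hadd T hT R hR h1 h2 =>
    rw [partialTrace_add hT hR]
    exact add_mem h1 h2
  | hsmul c T hT h =>
    rw [partialTrace_smul c hT]
    exact Submodule.smul_mem _ c h

theorem trace_partialTrace {S : HilbertTensor K H →L[ℂ] HilbertTensor K H}
    (hS : S ∈ traceClass (HilbertTensor K H)) : trace (partialTrace S) = trace S :=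
  (hasSum_trace_partialTrace hS).tsum_eq

theorem partialTrace_mul {S : HilbertTensor K H →L[ℂ] HilbertTensor K H}
    (hS : S ∈ traceClass (HilbertTensor K H)) (X : H →L[ℂ] H) :
    partialTrace S * X = partialTrace (S * tensorOp 1 X) := by
  ext y
  refine ext_inner_left ℂ fun x => ?_
  refine (hasSum_inner_partialTrace hS x (X y)).unique
    ((hasSum_inner_partialTrace (mul_mem_traceClass hS _) x y).congr_fun fun i => ?_)
  rw [mul_apply_eq_comp, tensorOp_elemTensor]
  rfl

theorem trace_partialTrace_mul {S : HilbertTensor K H →L[ℂ] HilbertTensor K H}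
    (hS : S ∈ traceClass (HilbertTensor K H)) (X : H →L[ℂ] H) :
    trace (partialTrace S * X) = trace (S * tensorOp 1 X) := by
  rw [partialTrace_mul hS, trace_partialTrace (mul_mem_traceClass hS _)]

variable (K H) in
/-- The partial trace as a linear map between the spaces of trace class operators. -/
noncomputable def partialTraceLinear : traceClass (HilbertTensor K H) →ₗ[ℂ] traceClass H where
  toFun S := ⟨partialTrace S.1, partialTrace_mem_traceClass S.2⟩
  map_add' S T := Subtype.ext (partialTrace_add S.2 T.2)
  map_smul' c S := Subtype.ext (partialTrace_smul c S.2)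

theorem isCompletelyPositive_partialTraceLinear :
    IsCompletelyPositive (partialTraceLinear K H) := by
  intro n T hT ξ
  -- The block form at ξ is a sum over k of block forms of `T` at the vectors eₖ ⊗ ξᵢ, each
  -- nonnegative.
  have h : HasSum (fun k => ∑ i, ∑ j, inner ℂ (elemTensor (basis K k) (ξ i))
      ((T i j).1 (elemTensor (basis K k) (ξ j))))
      (∑ i, ∑ j, inner ℂ (ξ i) (partialTrace (T i j).1 (ξ j))) :=
    hasSum_sum fun i _ => hasSum_sum fun j _ => hasSum_inner_partialTrace (T i j).2 (ξ i) (ξ j)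
  exact h.nonneg fun k => hT fun i => elemTensor (basis K k) (ξ i)

end PartialTrace

/-! ### Conjugation by a bounded operator -/

section Conjugation

variable {H : Type*} [NormedAddCommGroup H] [InnerProductSpace ℂ H] [CompleteSpace H]
variable {K : Type*} [NormedAddCommGroup K] [InnerProductSpace ℂ K] [CompleteSpace K]
variable {L : Type*} [NormedAddCommGroup L] [InnerProductSpace ℂ L] [CompleteSpace L]

open ContinuousLinearMap (adjoint)

/-- The map `T ↦ V T V*` on trace class operators. -/
noncomputable def conjugation (V : H →L[ℂ] K) : traceClass H →ₗ[ℂ] traceClass K where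
  toFun T := ⟨V ∘L (T : H →L[ℂ] H) ∘L adjoint V, comp_comp_mem_traceClass V T.2 _⟩
  map_add' S T := Subtype.ext (by
    simp only [Submodule.coe_add, ContinuousLinearMap.add_comp, ContinuousLinearMap.comp_add])
  map_smul' c S := Subtype.ext (by
    simp only [Submodule.coe_smul, ContinuousLinearMap.smul_comp, ContinuousLinearMap.comp_smul,
      RingHom.id_apply])

theorem isCompletelyPositive_conjugation (V : H →L[ℂ] K) :
    IsCompletelyPositive (conjugation V) := by
  intro n T hT ξ
  refine (hT fun i => adjoint V (ξ i)).trans_eq ?_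
  refine Finset.sum_congr rfl fun i _ => Finset.sum_congr rfl fun j _ => ?_
  exact ContinuousLinearMap.adjoint_inner_left _ _ _

theorem trace_conjugation_mul (V : H →L[ℂ] K) (T : traceClass H) (X : K →L[ℂ] K) :
    trace ((conjugation V T : K →L[ℂ] K) * X)
      = trace ((T : H →L[ℂ] H) * (adjoint V ∘L X ∘L V)) := by
  rw [← ContinuousLinearMap.comp_assoc, ← trace_comp_comp V T.2 (adjoint V ∘L X)]
  rfl

theorem trace_conjugation (V : H →L[ℂ] K) (T : traceClass H) :
    trace (conjugation V T : K →L[ℂ] K) = trace ((T : H →L[ℂ] H) * (adjoint V ∘L V)) :=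
  trace_comp_comp V T.2 (adjoint V)

theorem IsCompletelyPositive.comp {Φ : traceClass H →ₗ[ℂ] traceClass K}
    {Ψ : traceClass K →ₗ[ℂ] traceClass L} (hΨ : IsCompletelyPositive Ψ)
    (hΦ : IsCompletelyPositive Φ) : IsCompletelyPositive (Ψ ∘ₗ Φ) :=
  fun n T hT => hΨ n _ (hΦ n T hT)

end Conjugation

/-! ### Exchange of the tensor factors -/

section Swap

variable (K : Type*) [NormedAddCommGroup K] [InnerProductSpace ℂ K]
variable (H : Type*) [NormedAddCommGroup H] [InnerProductSpace ℂ H]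

open ContinuousLinearMap (adjoint)

/-- The swap `x ⊗ y ↦ y ⊗ x`. -/
noncomputable def swap : HilbertTensor K H →L[ℂ] HilbertTensor H K :=
  (TensorProduct.commIsometry ℂ K H).toContinuousLinearEquiv.toContinuousLinearMap.completion

variable {K H}

theorem swap_elemTensor (x : K) (y : H) : swap K H (elemTensor x y) = elemTensor y x := by
  unfold swap elemTensor
  rw [ContinuousLinearMap.completion_apply_coe]
  rfl

theorem adjoint_swap : adjoint (swap K H) = swap H K := by
  refine hilbertTensor_ext fun x y => hilbertTensor_ext_vec fun x' y' => ?_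
  rw [ContinuousLinearMap.adjoint_inner_left, swap_elemTensor, swap_elemTensor,
    inner_elemTensor, inner_elemTensor, mul_comm]

theorem swap_tensorOp_swap (S : H →L[ℂ] H) (T : K →L[ℂ] K) :
    swap H K ∘L tensorOp S T ∘L swap K H = tensorOp T S :=
  hilbertTensor_ext fun x y => by
    simp only [ContinuousLinearMap.comp_apply, swap_elemTensor, tensorOp_elemTensor]

theorem swap_swap : swap H K ∘L swap K H = 1 :=
  hilbertTensor_ext fun x y => by
    simp only [ContinuousLinearMap.comp_apply, swap_elemTensor, one_apply_eq_self]

end Swap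

/-! ### Joint observables and nondisturbing instruments -/

section Joint

variable {ΩA : Type*} [Fintype ΩA] {ΩB : Type*} [Fintype ΩB]
variable {H : Type*} [NormedAddCommGroup H] [InnerProductSpace ℂ H] [CompleteSpace H]
variable {K : Type*} [NormedAddCommGroup K] [InnerProductSpace ℂ K] [CompleteSpace K]
variable {A : Observable ΩA H} {B : Observable ΩB H}

open ContinuousLinearMap (adjoint)

theorem IsJointObservable.of_marginals {J : ΩA × ΩB → (H →L[ℂ] H)} (nonneg : ∀ z, 0 ≤ J z)
    (left : ∀ x, ∑ y, J (x, y) = A.effect x) (right : ∀ y, ∑ x, J (x, y) = B.effect y) :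
    IsJointObservable J A B where
  nonneg := nonneg
  sum_eq_one := by
    rw [Fintype.sum_prod_type, ← A.sum_effect]
    exact Finset.sum_congr rfl fun x _ => left x
  marginal_left := left
  marginal_right := right

theorem IsJointObservable.swap {J : ΩA × ΩB → (H →L[ℂ] H)} (h : IsJointObservable J A B) :
    IsJointObservable (fun z => J (z.2, z.1)) B A :=
  .of_marginals (fun _ => h.nonneg _) h.marginal_right h.marginal_left

theorem Broadcasts.reproduces {Λ : traceClass H →ₗ[ℂ] traceClass (HilbertTensor H H)}
    (hA : Broadcasts Λ A) (hB : Broadcasts Λ B) : Reproduces Λ A B A B :=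
  fun ρ hρ => ⟨fun x => (hA ρ hρ x).1, fun y => (hB ρ hρ y).2⟩

section Reproduces

variable {K' : Type*} [NormedAddCommGroup K'] [InnerProductSpace ℂ K'] [CompleteSpace K']
variable {Λ : traceClass H →ₗ[ℂ] traceClass (HilbertTensor K K')}
variable {A' : Observable ΩA K} {B' : Observable ΩB K'}

theorem Reproduces.left (h : Reproduces Λ A' B' A B) (x : ΩA) :
    traceMul (tensorOp (A'.effect x) 1) ∘ₗ Λ = traceMul (A.effect x) :=
  linearMap_ext_states fun ρ hρ => ((h ρ hρ).1 x).symm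

theorem Reproduces.right (h : Reproduces Λ A' B' A B) (y : ΩB) :
    traceMul (tensorOp 1 (B'.effect y)) ∘ₗ Λ = traceMul (B.effect y) :=
  linearMap_ext_states fun ρ hρ => ((h ρ hρ).2 y).symm

theorem Reproduces.isJointObservable (h : Reproduces Λ A' B' A B)
    (hΛ : IsCompletelyPositive Λ) {D : (HilbertTensor K K' →L[ℂ] HilbertTensor K K') →ₗ[ℂ] _}
    (hD : IsDualMap Λ D) :
    IsJointObservable (fun z => D (tensorOp (A'.effect z.1) (B'.effect z.2))) A B := by
  refine .of_marginals (fun z => hD.nonneg hΛ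
    (tensorOp_nonneg (A'.effect_nonneg _) (B'.effect_nonneg _))) (fun x => ?_) (fun y => ?_)
  · dsimp only
    rw [← map_sum, ← tensorOp_sum_right, B'.sum_effect]
    exact ext_traceMul ((isDualMap_iff.1 hD _).trans (h.left x))
  · dsimp only
    rw [← map_sum, ← tensorOp_sum_left, A'.sum_effect]
    exact ext_traceMul ((isDualMap_iff.1 hD _).trans (h.right y))

/-- This reduces measuring `B` without disturbing `A` to the opposite order. -/
theorem Reproduces.swap (h : Reproduces Λ A' B' A B) :
    Reproduces (conjugation (swap K K') ∘ₗ Λ) B' A' B A := by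
  intro ρ hρ
  refine ⟨fun y => ?_, fun x => ?_⟩
  · rw [(h ρ hρ).2 y, LinearMap.comp_apply, trace_conjugation_mul, adjoint_swap,
      swap_tensorOp_swap]
  · rw [(h ρ hρ).1 x, LinearMap.comp_apply, trace_conjugation_mul, adjoint_swap,
      swap_tensorOp_swap]

theorem IsChannel.swap (h : IsChannel Λ) : IsChannel (conjugation (swap K K') ∘ₗ Λ) where
  completelyPositive := (isCompletelyPositive_conjugation _).comp h.completelyPositive
  trace_preserving T := by
    rw [LinearMap.comp_apply, trace_conjugation, adjoint_swap, swap_swap, mul_one,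
      h.trace_preserving]

end Reproduces

theorem IsChannel.existsUnique_isDualMap {Λ : traceClass H →ₗ[ℂ] traceClass K}
    (h : IsChannel Λ) : ∃! D, IsDualMap Λ D :=
  QuantumMeasurement.existsUnique_isDualMap h.completelyPositive 1 fun T => by
    rw [mul_one, h.trace_preserving]

section LuedersInstrument

/-- The map `T ↦ tr_K[(√E ⊗ 1) Λ(T) (√E ⊗ 1)]`. -/
noncomputable def luedersMap (Λ : traceClass H →ₗ[ℂ] traceClass (HilbertTensor K H))
    (E : K →L[ℂ] K) : traceClass H →ₗ[ℂ] traceClass H :=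
  partialTraceLinear K H ∘ₗ conjugation (tensorOp (CFC.sqrt E) 1) ∘ₗ Λ

variable {Λ : traceClass H →ₗ[ℂ] traceClass (HilbertTensor K H)}

theorem adjoint_sqrt (E : K →L[ℂ] K) : adjoint (CFC.sqrt E) = CFC.sqrt E :=
  (IsSelfAdjoint.of_nonneg (CFC.sqrt_nonneg E)).star_eq

theorem adjoint_tensorOp_sqrt (E : K →L[ℂ] K) :
    adjoint (tensorOp (CFC.sqrt E) (1 : H →L[ℂ] H)) = tensorOp (CFC.sqrt E) 1 := by
  rw [adjoint_tensorOp, adjoint_sqrt]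
  congr 1
  exact star_one _

theorem coe_luedersMap (E : K →L[ℂ] K) (T : traceClass H) :
    (luedersMap Λ E T : H →L[ℂ] H) = partialTrace (tensorOp (CFC.sqrt E) 1 * (Λ T).1 *
      tensorOp (CFC.sqrt E) 1) := by
  change partialTrace (tensorOp (CFC.sqrt E) 1 ∘L (Λ T).1 ∘L
    adjoint (tensorOp (CFC.sqrt E) (1 : H →L[ℂ] H))) = _
  rw [adjoint_tensorOp_sqrt]
  rfl

theorem tensorOp_sqrt_sandwich {E : K →L[ℂ] K} (hE : 0 ≤ E) (X : H →L[ℂ] H) :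
    tensorOp (CFC.sqrt E) 1 ∘L tensorOp 1 X ∘L tensorOp (CFC.sqrt E) 1 = tensorOp E X := by
  have h : tensorOp (CFC.sqrt E) 1 * (tensorOp 1 X * tensorOp (CFC.sqrt E) 1)
      = tensorOp E X := by
    rw [tensorOp_mul, tensorOp_mul, one_mul, one_mul, mul_one, CFC.sqrt_mul_sqrt_self E hE]
  exact h

/-- The partial trace moves X to 1 ⊗ X, and cyclicity collects the two roots around it; they commute
with 1 ⊗ X and multiply to E. -/
theorem trace_luedersMap_mul {E : K →L[ℂ] K} (hE : 0 ≤ E) (T : traceClass H)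
    (X : H →L[ℂ] H) :
    trace ((luedersMap Λ E T : H →L[ℂ] H) * X) = trace ((Λ T).1 * tensorOp E X) := by
  rw [← tensorOp_sqrt_sandwich hE X]
  have h := trace_conjugation_mul (tensorOp (CFC.sqrt E) (1 : H →L[ℂ] H)) (Λ T) (tensorOp 1 X)
  rw [adjoint_tensorOp_sqrt] at h
  rw [← h]
  exact trace_partialTrace_mul (conjugation (tensorOp (CFC.sqrt E) 1) (Λ T)).2 X

theorem isInstrumentOf_luedersMap {A' : Observable ΩA K} (hΛ : IsChannel Λ)
    (h : Reproduces Λ A' B A B) : IsInstrumentOf (fun x => luedersMap Λ (A'.effect x)) A where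
  completelyPositive x := isCompletelyPositive_partialTraceLinear.comp
    ((isCompletelyPositive_conjugation _).comp hΛ.completelyPositive)
  trace_eq ρ hρ x := by
    rw [(h ρ hρ).1 x, ← trace_luedersMap_mul (A'.effect_nonneg x), mul_one]

theorem doesNotDisturb_luedersMap {A' : Observable ΩA K} (h : Reproduces Λ A' B A B) :
    DoesNotDisturb (fun x => luedersMap Λ (A'.effect x)) B := by
  intro ρ hρ y
  -- The identity on the first factor is expanded as ∑ A'(x), which splits the trace into the
  -- contributions of the single outcomes.
  rw [(h ρ hρ).2 y, ← A'.sum_effect, tensorOp_sum_left]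
  change traceMul _ (Λ ρ) = traceMul _ _
  rw [traceMul_sum, LinearMap.sum_apply, LinearMap.sum_apply, map_sum]
  exact Finset.sum_congr rfl fun x _ =>
    (trace_luedersMap_mul (A'.effect_nonneg x) ρ (B.effect y)).symm

end LuedersInstrument

section Instrument

variable {I : ΩA → (traceClass H →ₗ[ℂ] traceClass H)}

theorem IsInstrumentOf.traceMul_one_comp (hI : IsInstrumentOf I A) (x : ΩA) :
    traceMul 1 ∘ₗ I x = traceMul (A.effect x) :=
  linearMap_ext_states fun ρ hρ => (traceMul_one _).trans (hI.trace_eq ρ hρ x)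

/-- A single operation does not preserve the trace, but its trace functional is represented by A(x).
-/
theorem IsInstrumentOf.existsUnique_isDualMap (hI : IsInstrumentOf I A) (x : ΩA) :
    ∃! D, IsDualMap (I x) D :=
  QuantumMeasurement.existsUnique_isDualMap (hI.completelyPositive x) (A.effect x) fun T =>
    (traceMul_one _).symm.trans (LinearMap.congr_fun (hI.traceMul_one_comp x) T)

theorem IsInstrumentOf.isJointObservable (hI : IsInstrumentOf I A) (hB : DoesNotDisturb I B)
    {D : ΩA → ((H →L[ℂ] H) →ₗ[ℂ] (H →L[ℂ] H))} (hD : ∀ x, IsDualMap (I x) (D x)) :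
    IsJointObservable (fun z => D z.1 (B.effect z.2)) A B := by
  refine .of_marginals (fun z => (hD _).nonneg (hI.completelyPositive _) (B.effect_nonneg _))
    (fun x => ?_) (fun y => ext_traceMul ?_)
  · dsimp only
    rw [← map_sum, B.sum_effect]
    exact ext_traceMul ((isDualMap_iff.1 (hD x) _).trans (hI.traceMul_one_comp x))
  -- Summing the duals over x gives the dual of the total operation, which fixes the functional of
  -- B(y) by nondisturbance.
  · refine Eq.trans ?_ (linearMap_ext_states fun ρ hρ => (hB ρ hρ y).symm :
      traceMul (B.effect y) ∘ₗ (∑ x, I x) = traceMul (B.effect y))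
    ext T
    rw [traceMul_sum, LinearMap.comp_apply, LinearMap.sum_apply, LinearMap.sum_apply, map_sum]
    exact Finset.sum_congr rfl fun x _ => hD x T _

theorem MeasurableWithoutDisturbing.compatible (h : MeasurableWithoutDisturbing A B) :
    Compatible A B := by
  obtain ⟨I, hI, hB⟩ := h
  choose D hD using fun x => (hI.existsUnique_isDualMap x).exists
  exact ⟨_, hI.isJointObservable hB hD⟩

end Instrument

end Joint

end QuantumMeasurement

open QuantumMeasurement in
theorem mainTheorem1
    {ΩA : Type*} [Fintype ΩA] {ΩB : Type*} [Fintype ΩB]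
    {H : Type*} [NormedAddCommGroup H] [InnerProductSpace ℂ H] [CompleteSpace H]
    {K : Type*} [NormedAddCommGroup K] [InnerProductSpace ℂ K] [CompleteSpace K]
    (A : Observable ΩA H) (B : Observable ΩB H) :
    -- the chain of implications
    (Broadcastable A B → OneSideBroadcastable A B) ∧
    (OneSideBroadcastable A B → MutuallyNondisturbing A B) ∧
    (MutuallyNondisturbing A B → Nondisturbing A B) ∧
    (Nondisturbing A B → Compatible A B) ∧
    -- a channel that broadcasts both observables also broadcasts them one-sidedly
    (∀ Λ : traceClass H →ₗ[ℂ] traceClass (HilbertTensor H H),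
      IsChannel Λ → Broadcasts Λ A → Broadcasts Λ B → Reproduces Λ A B A B) ∧
    -- one-side broadcasting: `Λ*(A(x) ⊗ B(y))` is a joint observable
    (∀ Λ : traceClass H →ₗ[ℂ] traceClass (HilbertTensor H H),
      IsChannel Λ → Reproduces Λ A B A B →
        (∃! D, IsDualMap Λ D) ∧
        ∀ D, IsDualMap Λ D →
          IsJointObservable (fun z => D (tensorOp (A.effect z.1) (B.effect z.2))) A B) ∧
    -- `Iₓ(ρ) = tr_K[(√A'(x) ⊗ 1) Λ(ρ) (√A'(x) ⊗ 1)]` measures `A` without disturbing `B`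
    (∀ (A' : Observable ΩA K) (Λ : traceClass H →ₗ[ℂ] traceClass (HilbertTensor K H)),
      IsChannel Λ → Reproduces Λ A' B A B →
        ∃ I : ΩA → (traceClass H →ₗ[ℂ] traceClass H),
          (∀ x ρ, (I x ρ : H →L[ℂ] H) =
            partialTrace (tensorOp (CFC.sqrt (A'.effect x)) 1 * (Λ ρ).1 *
              tensorOp (CFC.sqrt (A'.effect x)) 1)) ∧
          IsInstrumentOf I A ∧ DoesNotDisturb I B) ∧
    -- a nondisturbing measurement of `A` followed by `B`: `Iₓ*(B(y))` is a joint observable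
    (∀ I : ΩA → (traceClass H →ₗ[ℂ] traceClass H),
      IsInstrumentOf I A → DoesNotDisturb I B →
        (∀ x, ∃! D, IsDualMap (I x) D) ∧
        ∀ D : ΩA → ((H →L[ℂ] H) →ₗ[ℂ] (H →L[ℂ] H)), (∀ x, IsDualMap (I x) (D x)) →
          IsJointObservable (fun z => D z.1 (B.effect z.2)) A B) := by
  refine ⟨?_, ?_, Or.inl ∘ And.left, ?_, fun Λ _ hA hB => hA.reproduces hB, ?_, ?_, ?_⟩
  · rintro ⟨Λ, hΛ, hA, hB⟩
    exact ⟨Λ, hΛ, hA.reproduces hB⟩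
  · rintro ⟨Λ, hΛ, h⟩
    -- Here `K` is `H` and the pointer observable is `A` itself; the second half uses the swapped
    -- channel, with `B` as pointer.
    exact ⟨⟨_, isInstrumentOf_luedersMap hΛ h, doesNotDisturb_luedersMap h⟩,
      ⟨_, isInstrumentOf_luedersMap hΛ.swap h.swap, doesNotDisturb_luedersMap h.swap⟩⟩
  · rintro (h | h)
    · exact h.compatible
    · obtain ⟨J, hJ⟩ := h.compatible
      exact ⟨_, hJ.swap⟩
  · exact fun Λ hΛ h => ⟨hΛ.existsUnique_isDualMap,
      fun D hD => h.isJointObservable hΛ.completelyPositive hD⟩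
  · exact fun A' Λ hΛ h => ⟨fun x => luedersMap Λ (A'.effect x),
      fun x ρ => coe_luedersMap _ _, isInstrumentOf_luedersMap hΛ h, doesNotDisturb_luedersMap h⟩
  · exact fun I hI hB => ⟨hI.existsUnique_isDualMap, fun D hD => hI.isJointObservable hB hD⟩
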